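/- **Setting.** On the Riemann sphere $\mathbb{CP}(1)$, with affine coordinate $w\mapsto[1:w]$, let $\Omega=\frac{i}{(1+|w|^2)^2}\,dw\wedge d\bar w$ be the Fubini–Study form, which has total mass $2\pi$, and let $\mu=\frac1{2\pi}\Omega$ be the normalized area measure. For $m\ge 0$ let $\mathbf L^{\otimes m}$ be the $m$-th power of the hyperplane bundle. In the coordinate $w$, its square-integrable sections form the Hilbert space $\Gamma^m_2$ with inner product $\int s_1\overline{s_2}\,(1+|w|^2)^{-m}\,d\Omega$, and its holomorphic sections form the subspace $\Gamma^m_{hol}=\mathrm{span}\{1,w,\dots,w^m\}$. Let $P^m:\Gamma^m_2\to\Gamma^m_{hol}$ be the orthogonal projection. The Toeplitz quantization of a real function $f\in C^\infty(\mathbb{CP}(1))$ is the operator $T^m_f=P^m\circ M_f\circ P^m$ on $\Gamma^m_{hol}$, where $M_f$ is multiplication by $f$. It is self-adjoint; let $\lambda^m=(\lambda^m_0,\dots,\lambda^m_m)$ be its eigenvalues, counted with multiplicity, in non-increasing order. For a real measurable function $h$ on a probability space $(X,\nu)$, the decreasing rearrangement is $h^*(s)=\inf\{t\in\mathbb R :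 \nu\{h\ge t\}<s\}$, $0<s\le 1$. For integrable $g,h$, write $g\prec h$ if $\int_0^s g^*\le\int_0^s h^*$ for all $0\le s<1$ and $\int_0^1 g^*=\int_0^1 h^*$. Let $f^*$ be the decreasing rearrangement of $f$ with respect to $\mu$, and let $\Omega(f^*)=\{g\in L^2([0,1]) : g\prec f^*\}$, where $L^2([0,1])$ is the real Hilbert space with respect to Lebesgue measure. Let $\mathrm{Smeas}(I)$ be the set of all (not necessarily invertible) Lebesgue measure preserving maps $\phi:[0,1]\to[0,1]$. Let $\Sigma_m\cdot\lambda^m$ be the set of all vectors obtained from $\lambda^m$ by permuting its $m+1$ coordinates, $co$ the convex hull in $\mathbb R^{m+1}$, and $p^m:\mathbb R^{m+1}\to L^2([0,1])$ the map $p^m(a_0,\dots,a_m)=\sum_{k=0}^m a_k\,\chi_{[k/(m+1),\,(k+1)/(m+1))}$. Put $E_m=p^m(co(\Sigma_m\cdot\lambda^m))$. The topological lim sup $Ls\,E_m$ is the set of all $x\in L^2([0,1])$ such that every norm neighborhood $V$ of $x$ satisfies $V\cap E_m\ne\emptyset$ for infinitely many $m$. **Theorem.** Let $f\in C^\infty(\mathbb{CP}(1))$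 be real-valued. Then the closure of $Ls\,E_m$ in the weak topology of $L^2([0,1])$ equals $\Omega(f^*)$, and the closed convex hull of $\mathrm{Smeas}(I)\cdot f^*=\{f^*\circ\phi : \phi\in\mathrm{Smeas}(I)\}$ in $L^2([0,1])$ equals the same set: $$\overline{co}\,(\mathrm{Smeas}(I)\cdot f^*)=\overline{Ls\,E_m}^{\,weak}=\Omega(f^*).$$ -/

import Mathlib

open MeasureTheory Set Filter Topology
open scoped ENNReal ContDiff unitInterval

noncomputable section

namespace ToeplitzConvexity

/-! ### The Riemann sphere, its smooth functions and its area measure -/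

/-- The complex projective line, as the set of lines through the origin of `ℂ²`. -/
def CP1 : Type := Projectivization ℂ (Fin 2 → ℂ)

/-- The quotient topology of `ℂ² ∖ {0}`. -/
instance : TopologicalSpace CP1 :=
  TopologicalSpace.coinduced (fun v : {v : Fin 2 → ℂ // v ≠ 0} => Projectivization.mk' ℂ v)
    inferInstance

instance : MeasurableSpace CP1 := borel CP1

instance : BorelSpace CP1 := ⟨rfl⟩

/-- The affine coordinate `w ↦ [1 : w]`. -/
def affineChart (w : ℂ) : CP1 :=
  Projectivization.mk ℂ ![1, w] (fun h => one_ne_zero (congrFun h 0))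

/-- The affine coordinate at the other pole, `u ↦ [u : 1]`. -/
def affineChartInfty (u : ℂ) : CP1 :=
  Projectivization.mk ℂ ![u, 1] (fun h => one_ne_zero (congrFun h 1))

/-- `f` is a real-valued `C^∞` function on `ℂP(1)`: it is smooth (in the real sense) in each of
the two affine coordinates, which form an atlas of `ℂP(1)`. -/
def IsSmooth (f : CP1 → ℝ) : Prop :=
  ContDiff ℝ ∞ (fun w : ℂ => f (affineChart w)) ∧
    ContDiff ℝ ∞ (fun u : ℂ => f (affineChartInfty u))

/-- The measure on the affine coordinate plane given by the Fubini-Study form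
`Ω = i dw ∧ dw̄ / (1 + |w|²)² = 2 dx ∧ dy / (1 + |w|²)²`. -/
def fubiniStudy : Measure ℂ :=
  (volume : Measure ℂ).withDensity (fun w => ENNReal.ofReal (2 / (1 + ‖w‖ ^ 2) ^ 2))

/-- The normalized area measure `Ω / 2π` on `ℂP(1)` (the complement of the affine coordinate plane
is one point, which has area zero). -/
def areaMeasure : Measure CP1 :=
  ENNReal.ofReal (1 / (2 * Real.pi)) • fubiniStudy.map affineChart

/-! ### Decreasing rearrangement and majorization -/

/-- The distribution function `F_f(t) = μ {f < t}`. -/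
def distributionFunction {X : Type*} [MeasurableSpace X] (μ : Measure X) (f : X → ℝ) (t : ℝ) : ℝ :=
  μ.real {x | f x < t}

/-- The decreasing rearrangement `f^*(s) = inf {t | d_f(t) < s}`, where
`d_f(t) = μ(X) - F_f(t)`. Here `t` ranges over all of `ℝ`, as `f` need not be nonnegative. -/
def decreasingRearrangement {X : Type*} [MeasurableSpace X] (μ : Measure X) (f : X → ℝ) (s : ℝ) :
    ℝ :=
  sInf {t : ℝ | μ.real univ - distributionFunction μ f t < s}

/-- `g ≺ f`, that is, `f` majorizes `g`. -/
def IsMajorizedBy {X : Type*} [MeasurableSpace X] (μ : Measure X) (g f : X → ℝ) : Prop :=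
  (∀ s ∈ Ico (0 : ℝ) 1, ∫ z in (0 : ℝ)..s, decreasingRearrangement μ g z ≤
      ∫ z in (0 : ℝ)..s, decreasingRearrangement μ f z) ∧
    ∫ z in (0 : ℝ)..1, decreasingRearrangement μ g z =
      ∫ z in (0 : ℝ)..1, decreasingRearrangement μ f z

/-- The real Hilbert space `L²([0,1])`. -/
abbrev L2I : Type := Lp ℝ 2 (volume : Measure I)

/-- The decreasing rearrangement of a function on `ℂP(1)`, as a function on `[0,1]`. -/
def rearr (f : CP1 → ℝ) (s : I) : ℝ := decreasingRearrangement areaMeasure f s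

/-- `Ω(f^*) = {g ∈ L²([0,1]) | g ≺ f^*}`. -/
def majorizedSet (f : CP1 → ℝ) : Set L2I :=
  {g | IsMajorizedBy (volume : Measure I) g (rearr f)}

/-! ### Basic facts on the area measure -/

theorem continuous_affineChart : Continuous affineChart := by
  have h : Continuous (fun v : {v : Fin 2 → ℂ // v ≠ 0} =>
      show CP1 from Projectivization.mk' ℂ v) := continuous_coinduced_rng
  have h2 : Continuous (fun w : ℂ =>
      (⟨![1, w], fun h => one_ne_zero (congrFun h 0)⟩ : {v : Fin 2 → ℂ // v ≠ 0})) := by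
    refine Continuous.subtype_mk ?_ _
    refine continuous_pi fun i => ?_
    fin_cases i
    · exact continuous_const
    · exact continuous_id
  exact h.comp h2

theorem measurable_fubiniStudy_density :
    Measurable (fun w : ℂ => ENNReal.ofReal (2 / (1 + ‖w‖ ^ 2) ^ 2)) := by
  fun_prop

theorem integrable_and_integral_radial :
    IntegrableOn (fun r : ℝ => r * (2 / (1 + r ^ 2) ^ 2)) (Ioi 0) ∧
      ∫ r in Ioi (0 : ℝ), r * (2 / (1 + r ^ 2) ^ 2) = 1 := by
  have hd : ∀ x ∈ Ici (0 : ℝ), HasDerivAt (fun r : ℝ => -(1 + r ^ 2)⁻¹)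
      (x * (2 / (1 + x ^ 2) ^ 2)) x := by
    intro x _
    have h0 : (1 + x ^ 2) ≠ 0 := by positivity
    have h1 : HasDerivAt (fun r : ℝ => 1 + r ^ 2) (2 * x) x := by
      simpa using (hasDerivAt_pow 2 x).const_add 1
    have h2 : x * (2 / (1 + x ^ 2) ^ 2) = -(-(2 * x) / (1 + x ^ 2) ^ 2) := by ring
    rw [h2]
    exact (h1.fun_inv h0).fun_neg
  have ht : Tendsto (fun r : ℝ => -(1 + r ^ 2)⁻¹) atTop (𝓝 0) := by
    have : Tendsto (fun r : ℝ => 1 + r ^ 2) atTop atTop :=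
      tendsto_atTop_add_const_left _ _ (tendsto_pow_atTop two_ne_zero)
    simpa using this.inv_tendsto_atTop.neg
  have hpos : ∀ x ∈ Ioi (0 : ℝ), 0 ≤ x * (2 / (1 + x ^ 2) ^ 2) := by
    intro x hx
    have : (0 : ℝ) < x := hx
    positivity
  refine ⟨integrableOn_Ioi_deriv_of_nonneg' hd hpos ht, ?_⟩
  rw [integral_Ioi_of_hasDerivAt_of_nonneg' hd hpos ht]
  norm_num

theorem fubiniStudy_univ : fubiniStudy univ = ENNReal.ofReal (2 * Real.pi) := by
  have hR := integrable_and_integral_radial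
  rw [fubiniStudy, withDensity_apply _ MeasurableSet.univ, Measure.restrict_univ,
    ← Complex.lintegral_comp_polarCoord_symm]
  have : ∀ p ∈ polarCoord.target, ENNReal.ofReal p.1 •
      ENNReal.ofReal (2 / (1 + ‖Complex.polarCoord.symm p‖ ^ 2) ^ 2) =
        ENNReal.ofReal (p.1 * (2 / (1 + p.1 ^ 2) ^ 2)) * 1 := by
    intro p hp
    have hp1 : 0 < p.1 := by
      rw [polarCoord_target] at hp
      exact hp.1
    rw [Complex.norm_polarCoord_symm, sq_abs, smul_eq_mul, ← ENNReal.ofReal_mul hp1.le, mul_one]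
  rw [setLIntegral_congr_fun polarCoord.open_target.measurableSet this, polarCoord_target,
    Measure.volume_eq_prod, ← Measure.prod_restrict,
    lintegral_prod_mul (f := fun r : ℝ => ENNReal.ofReal (r * (2 / (1 + r ^ 2) ^ 2)))
      (g := fun _ => 1) (by fun_prop) (by fun_prop),
    ← ofReal_integral_eq_lintegral_ofReal hR.1, hR.2]
  · rw [ENNReal.ofReal_one, one_mul, lintegral_one, Measure.restrict_apply_univ,
      Real.volume_Ioo]
    ring_nf
  · filter_upwards [ae_restrict_mem measurableSet_Ioi] with x hx
    have : (0 : ℝ) < x := hx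
    positivity

instance : IsFiniteMeasure fubiniStudy := ⟨by rw [fubiniStudy_univ]; exact ENNReal.ofReal_lt_top⟩

instance : IsProbabilityMeasure areaMeasure := ⟨by
  rw [areaMeasure, Measure.smul_apply, Measure.map_apply continuous_affineChart.measurable
    MeasurableSet.univ, preimage_univ, fubiniStudy_univ, smul_eq_mul,
    ← ENNReal.ofReal_mul (by positivity), one_div,
    inv_mul_cancel₀ (by positivity), ENNReal.ofReal_one]⟩

theorem IsSmooth.bounded {f : CP1 → ℝ} (hf : IsSmooth f) : ∃ C : ℝ, 0 ≤ C ∧ ∀ p, |f p| ≤ C := by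
  obtain ⟨C₀, h₀⟩ := (isCompact_closedBall (0 : ℂ) 1).exists_bound_of_continuousOn
    hf.1.continuous.continuousOn
  obtain ⟨C₁, h₁⟩ := (isCompact_closedBall (0 : ℂ) 1).exists_bound_of_continuousOn
    hf.2.continuous.continuousOn
  simp only [mem_closedBall_zero_iff, Real.norm_eq_abs] at h₀ h₁
  refine ⟨max C₀ C₁, ?_, fun p => ?_⟩
  · exact ((abs_nonneg _).trans (h₀ 0 (by simp))).trans (le_max_left _ _)
  · induction p using Projectivization.ind with
    | h v hv =>
      by_cases hle : ‖v 1‖ ≤ ‖v 0‖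
      · have hne : v 0 ≠ 0 := by
          intro h0
          apply hv
          have h1 : v 1 = 0 := by simpa [h0] using hle
          ext i
          fin_cases i
          · exact h0
          · exact h1
        have hp : (Projectivization.mk ℂ v hv : CP1) = affineChart (v 1 / v 0) := by
          refine (Projectivization.mk_eq_mk_iff' _ _ _ _ _).2 ⟨v 0, ?_⟩
          ext i
          fin_cases i
          · simp
          · simp [mul_div_cancel₀, hne]
        rw [hp]
        refine (h₀ _ ?_).trans (le_max_left _ _)
        rw [norm_div]
        exact div_le_one_of_le₀ hle (norm_nonneg _)
      · have hne : v 1 ≠ 0 := by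
          intro h0
          simp [h0] at hle
        have hp : (Projectivization.mk ℂ v hv : CP1) = affineChartInfty (v 0 / v 1) := by
          refine (Projectivization.mk_eq_mk_iff' _ _ _ _ _).2 ⟨v 1, ?_⟩
          ext i
          fin_cases i
          · simp [mul_div_cancel₀, hne]
          · simp
        rw [hp]
        refine (h₁ _ ?_).trans (le_max_right _ _)
        rw [norm_div]
        exact div_le_one_of_le₀ (not_le.1 hle).le (norm_nonneg _)

/-! ### The orbit of `f^*` under measure preserving transformations -/

theorem decreasingRearrangement_mem {f : CP1 → ℝ} {C : ℝ} (hC : ∀ p, |f p| ≤ C) {s : ℝ}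
    (hs : s ∈ Ioc (0 : ℝ) 1) :
    C + 1 ∈ {t : ℝ | areaMeasure.real univ - distributionFunction areaMeasure f t < s} ∧
      -C ∈ lowerBounds
        {t : ℝ | areaMeasure.real univ - distributionFunction areaMeasure f t < s} := by
  constructor
  · have : {x | f x < C + 1} = univ :=
      eq_univ_of_forall fun x => (le_abs_self _).trans_lt ((hC x).trans_lt (lt_add_one C))
    simp only [mem_ofPred_eq, distributionFunction, this, sub_self]
    exact hs.1
  · intro t ht
    by_contra! hlt
    have : {x | f x < t} = ∅ :=
      eq_empty_of_forall_notMem fun x hx => by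
        have h1 := (abs_le.1 (hC x)).1
        have h2 : f x < t := hx
        linarith
    simp only [mem_ofPred_eq, distributionFunction, this, measureReal_empty, sub_zero,
      probReal_univ] at ht
    exact absurd ht (not_lt.2 hs.2)

theorem IsSmooth.memLp_rearr {f : CP1 → ℝ} (hf : IsSmooth f) :
    MemLp (rearr f) 2 (volume : Measure I) := by
  obtain ⟨C, hC0, hC⟩ := hf.bounded
  have hanti : AntitoneOn (decreasingRearrangement areaMeasure f) (Ioc 0 1) := by
    intro a ha b hb hab
    exact csInf_le_csInf ⟨-C, (decreasingRearrangement_mem hC hb).2⟩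
      ⟨C + 1, (decreasingRearrangement_mem hC ha).1⟩ fun t ht => lt_of_lt_of_le ht hab
  have hmeas : AEMeasurable (decreasingRearrangement areaMeasure f)
      ((volume : Measure ℝ).restrict I) := by
    have h1 := aemeasurable_restrict_of_antitoneOn (μ := (volume : Measure ℝ))
      measurableSet_Ioc hanti
    rwa [restrict_Ioc_eq_restrict_Icc] at h1
  refine MemLp.of_bound (C := C + 1) ?_ ?_
  · exact (hmeas.comp_quasiMeasurePreserving
      unitInterval.measurePreserving_coe.quasiMeasurePreserving).aestronglyMeasurable
  · refine Eventually.of_forall fun s => ?_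
    rcases eq_or_lt_of_le s.2.1 with h0 | h0
    · have he : {t : ℝ | areaMeasure.real univ - distributionFunction areaMeasure f t < s} = ∅ := by
        refine eq_empty_of_forall_notMem fun t ht => ?_
        have h2 : areaMeasure.real univ - distributionFunction areaMeasure f t < s := ht
        have h3 : distributionFunction areaMeasure f t ≤ areaMeasure.real univ :=
          measureReal_mono (subset_univ _)
        rw [← h0] at h2
        linarith
      rw [rearr, decreasingRearrangement, he, Real.sInf_empty, norm_zero]
      linarith
    · have hm := decreasingRearrangement_mem hC (s := s) ⟨h0, s.2.2⟩
      rw [Real.norm_eq_abs, abs_le]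
      constructor
      · exact (by linarith : -(C + 1) ≤ -C).trans (le_csInf ⟨_, hm.1⟩ hm.2)
      · exact csInf_le ⟨_, hm.2⟩ hm.1

/-- `f^*` as an element of `L²([0,1])`. -/
def rearrL2 (f : CP1 → ℝ) (hf : IsSmooth f) : L2I := hf.memLp_rearr.toLp (rearr f)

/-- `Smeas(I) · f^* = {f^* ∘ φ | φ ∈ Smeas(I)}`, where `Smeas(I)` is the set of all (not necessarily
invertible) measure preserving transformations of `[0,1]`. -/
def smeasOrbit (f : CP1 → ℝ) (hf : IsSmooth f) : Set L2I :=
  {g | ∃ (φ : I → I) (hφ : MeasurePreserving φ volume volume),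
    g = Lp.compMeasurePreserving φ hφ (rearrL2 f hf)}

/-! ### Toeplitz quantization -/

/-- The weight `Ω / (1 + |w|²)^m`, so that `∫ s₁ s̄₂ / (1 + |w|²)^m dΩ` is the inner product of the
sections of `L^{⊗m}` given by `s₁`, `s₂` in the affine coordinate. -/
def sectionMeasure (m : ℕ) : Measure ℂ :=
  fubiniStudy.withDensity (fun w => ENNReal.ofReal (1 / (1 + ‖w‖ ^ 2) ^ m))

/-- The Hilbert space of square-integrable sections of `L^{⊗m}`, in the affine coordinate. -/
abbrev L2Sections (m : ℕ) : Type := Lp ℂ 2 (sectionMeasure m)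

theorem memLp_monomial (m : ℕ) (k : Fin (m + 1)) :
    MemLp (fun w : ℂ => w ^ (k : ℕ)) 2 (sectionMeasure m) := by
  refine ⟨(by fun_prop : Continuous fun w : ℂ => w ^ (k : ℕ)).aestronglyMeasurable, ?_⟩
  rw [eLpNorm_lt_top_iff_lintegral_rpow_enorm_lt_top two_ne_zero ENNReal.ofNat_ne_top,
    sectionMeasure, lintegral_withDensity_eq_lintegral_mul _ (by fun_prop) (by fun_prop)]
  refine lt_of_le_of_lt (lintegral_mono (g := fun _ => 1) fun w => ?_) (by simp)
  simp only [Pi.mul_apply, ENNReal.toReal_ofNat, ENNReal.rpow_ofNat]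
  rw [← ofReal_norm, ← ENNReal.ofReal_pow (norm_nonneg _),
    ← ENNReal.ofReal_mul (by positivity), ← ENNReal.ofReal_one]
  refine ENNReal.ofReal_le_ofReal ?_
  rw [norm_pow, one_div, inv_mul_le_one₀ (by positivity), ← pow_mul, mul_comm, pow_mul]
  calc (‖w‖ ^ 2) ^ (k : ℕ) ≤ (1 + ‖w‖ ^ 2) ^ (k : ℕ) := by gcongr; linarith
    _ ≤ (1 + ‖w‖ ^ 2) ^ m :=
      pow_le_pow_right₀ (by nlinarith [sq_nonneg ‖w‖]) (Nat.lt_succ_iff.1 k.2)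

/-- The holomorphic section `w^k` of `L^{⊗m}`, for `0 ≤ k ≤ m`. -/
def monomialSection (m : ℕ) (k : Fin (m + 1)) : L2Sections m :=
  (memLp_monomial m k).toLp (fun w : ℂ => w ^ (k : ℕ))

/-- The space of holomorphic sections of `L^{⊗m}`: the span of `1, w, …, w^m`. -/
def holSections (m : ℕ) : Submodule ℂ (L2Sections m) :=
  Submodule.span ℂ (range (monomialSection m))

instance (m : ℕ) : FiniteDimensional ℂ (holSections m) :=
  FiniteDimensional.span_of_finite ℂ (finite_range _)

theorem volume_absolutelyContinuous (m : ℕ) : (volume : Measure ℂ) ≪ sectionMeasure m := by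
  refine (withDensity_absolutelyContinuous' (μ := (volume : Measure ℂ))
    measurable_fubiniStudy_density.aemeasurable
    (Eventually.of_forall fun w => ?_)).trans
    (withDensity_absolutelyContinuous' (μ := fubiniStudy) (by fun_prop)
      (Eventually.of_forall fun w => ?_))
  · exact (ENNReal.ofReal_pos.2 (by positivity)).ne'
  · exact (ENNReal.ofReal_pos.2 (by positivity)).ne'

instance (m : ℕ) : (sectionMeasure m).IsOpenPosMeasure :=
  (volume_absolutelyContinuous m).isOpenPosMeasure

theorem linearIndependent_monomialSection (m : ℕ) :
    LinearIndependent ℂ (monomialSection m) := by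
  rw [Fintype.linearIndependent_iff]
  intro c hc
  have h1 : (fun w : ℂ => ∑ k : Fin (m + 1), c k * w ^ (k : ℕ)) =ᵐ[sectionMeasure m]
      fun _ => 0 := by
    have hk : ∀ᵐ w ∂(sectionMeasure m), ∀ k : Fin (m + 1),
        (c k • monomialSection m k : L2Sections m) w = c k * w ^ (k : ℕ) := by
      rw [ae_all_iff]
      intro k
      filter_upwards [Lp.coeFn_smul (c k) (monomialSection m k),
        (memLp_monomial m k).coeFn_toLp] with w h1 h2
      rw [h1, Pi.smul_apply, monomialSection, h2, smul_eq_mul]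
    have hz : ((∑ k, c k • monomialSection m k : L2Sections m) : ℂ → ℂ)
        =ᵐ[sectionMeasure m] fun _ => 0 := by
      rw [hc]
      exact Lp.coeFn_zero _ _ _
    filter_upwards [hk, hz, Lp.coeFn_finsetSum Finset.univ
      (fun k => c k • monomialSection m k)] with w h1 h2 h3
    rw [h3, Finset.sum_apply] at h2
    rw [← h2]
    exact Finset.sum_congr rfl fun k _ => (h1 k).symm
  have h2 := (Continuous.ae_eq_iff_eq (sectionMeasure m) (by fun_prop) (by fun_prop)).1 h1
  have h3 : (∑ k : Fin (m + 1), Polynomial.monomial (k : ℕ) (c k)) = 0 := by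
    refine Polynomial.funext fun w => ?_
    have := congrFun h2 w
    simpa [Polynomial.eval_finsetSum] using this
  intro i
  have := congrArg (fun p => Polynomial.coeff p (i : ℕ)) h3
  simpa [Polynomial.finsetSum_coeff, Polynomial.coeff_monomial, Fin.val_inj] using this

theorem finrank_holSections (m : ℕ) : Module.finrank ℂ (holSections m) = m + 1 := by
  rw [holSections, finrank_span_eq_card (linearIndependent_monomialSection m), Fintype.card_fin]

theorem IsSmooth.memLp_mul {f : CP1 → ℝ} (hf : IsSmooth f) {m : ℕ} (s : L2Sections m) :
    MemLp (fun w => (f (affineChart w) : ℂ) * s w) 2 (sectionMeasure m) := by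
  obtain ⟨C, -, hC⟩ := hf.bounded
  refine MemLp.of_le_mul (c := C) (Lp.memLp s) ?_ (Eventually.of_forall fun w => ?_)
  · exact (Complex.continuous_ofReal.comp hf.1.continuous).aestronglyMeasurable.mul
      (Lp.aestronglyMeasurable s)
  · rw [norm_mul, Complex.norm_real, Real.norm_eq_abs]
    gcongr
    exact hC _

/-- The operator `M_f` of multiplication by `f` on square-integrable sections. -/
def mulOperator (f : CP1 → ℝ) (hf : IsSmooth f) (m : ℕ) : L2Sections m →ₗ[ℂ] L2Sections m where
  toFun s := (hf.memLp_mul s).toLp (fun w => (f (affineChart w) : ℂ) * s w)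
  map_add' s t := by
    rw [← MemLp.toLp_add, MemLp.toLp_eq_toLp_iff]
    filter_upwards [Lp.coeFn_add s t] with w hw
    simp only [hw, Pi.add_apply, mul_add]
  map_smul' c s := by
    rw [RingHom.id_apply, ← MemLp.toLp_const_smul, MemLp.toLp_eq_toLp_iff]
    filter_upwards [Lp.coeFn_smul c s] with w hw
    simp only [hw, Pi.smul_apply, smul_eq_mul]
    ring

/-- The Toeplitz quantization `T_f^m = P^m ∘ M_f ∘ P^m` on the space of holomorphic sections,
where `P^m` is the orthogonal projection onto that space. -/
def toeplitz (f : CP1 → ℝ) (hf : IsSmooth f) (m : ℕ) : holSections m →ₗ[ℂ] holSections m :=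
  (holSections m).orthogonalProjectionOnto.toLinearMap ∘ₗ mulOperator f hf m ∘ₗ (holSections m).subtype

theorem toeplitz_isSymmetric (f : CP1 → ℝ) (hf : IsSmooth f) (m : ℕ) :
    (toeplitz f hf m).IsSymmetric := by
  intro s t
  change inner ℂ ((holSections m).orthogonalProjectionOnto (mulOperator f hf m s)) t =
    inner ℂ s ((holSections m).orthogonalProjectionOnto (mulOperator f hf m t))
  rw [Submodule.inner_orthogonalProjectionOnto_eq_of_mem_right,
    Submodule.inner_orthogonalProjectionOnto_eq_of_mem_left, L2.inner_def, L2.inner_def]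
  refine integral_congr_ae ?_
  filter_upwards [(hf.memLp_mul (s : L2Sections m)).coeFn_toLp,
    (hf.memLp_mul (t : L2Sections m)).coeFn_toLp] with w h1 h2
  simp only [mulOperator, LinearMap.coe_mk, AddHom.coe_mk, h1, h2]
  simp only [RCLike.inner_apply, map_mul, Complex.conj_ofReal]
  ring

/-- The eigenvalues `λ^m_0 ≥ … ≥ λ^m_m` of `T_f^m`, counted with multiplicity. -/
def toeplitzEigenvalues (f : CP1 → ℝ) (hf : IsSmooth f) (m : ℕ) : Fin (m + 1) → ℝ :=
  (toeplitz_isSymmetric f hf m).eigenvalues (finrank_holSections m)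

/-! ### The convex sets `E_m` and their topological lim sup -/

/-- The interval `I^m_k = [k/(m+1), (k+1)/(m+1))`, as a subset of `[0,1]`. -/
def stepInterval (m : ℕ) (k : Fin (m + 1)) : Set I :=
  {x | (k : ℝ) / (m + 1) ≤ x ∧ (x : ℝ) < (k + 1) / (m + 1)}

theorem measurableSet_stepInterval (m : ℕ) (k : Fin (m + 1)) :
    MeasurableSet (stepInterval m k) :=
  (measurableSet_le measurable_const measurable_subtype_coe).inter
    (measurableSet_lt measurable_subtype_coe measurable_const)

/-- The map `p^m : ℝ^{m+1} → L²([0,1])`, `a ↦ ∑ₖ aₖ χ_{I^m_k}`. -/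
def stepMap (m : ℕ) (a : Fin (m + 1) → ℝ) : L2I :=
  ∑ k, indicatorConstLp 2 (measurableSet_stepInterval m k)
    (measure_ne_top (volume : Measure I) _) (a k)

/-- The permutohedron `co(Σ_m · x)`: the convex hull of all rearrangements of `x`. -/
def permutohedron {m : ℕ} (x : Fin (m + 1) → ℝ) : Set (Fin (m + 1) → ℝ) :=
  convexHull ℝ (range fun τ : Equiv.Perm (Fin (m + 1)) => x ∘ τ)

/-- `E_m = p^m(co(Σ_m · λ^m))`. -/
def stepSet (f : CP1 → ℝ) (hf : IsSmooth f) (m : ℕ) : Set L2I :=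
  stepMap m '' permutohedron (toeplitzEigenvalues f hf m)

/-- The topological lim sup of a sequence of subsets: the set of points all of whose neighborhoods
meet infinitely many sets of the sequence. -/
def topLimsup {X : Type*} [TopologicalSpace X] (E : ℕ → Set X) : Set X :=
  {x | ∀ V ∈ 𝓝 x, {m | (V ∩ E m).Nonempty}.Infinite}

/-- The closure of a subset of `L²([0,1])` in the weak topology. -/
def weakClosure (S : Set L2I) : Set L2I :=
  toWeakSpace ℝ L2I ⁻¹' closure (toWeakSpace ℝ L2I '' S)

end ToeplitzConvexity

end

open ToeplitzConvexity

/-!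
By the Hardy–Littlewood inequality, `g ≺ f^*` means that `∫_A g ≤ ∫_0^{|A|} f^*` for all measurable
`A`, with equality for `A = [0,1]`. Hence `Ω(f^*)` is closed and convex, and by Rado's theorem the
averages of `g ≺ f^*` over the step intervals form a point of the permutohedron of the averages of
`f^*`. Step averages converge in `L²`, and permuting the step intervals is measure preserving, so
`g` is a limit of convex combinations of rearrangements of `f^*`, and likewise of any functions
`v_m → f^*` in place of `f^*`.

The functions `p^m(λ^m)` are such a sequence `v_m`. They satisfy `p^m(λ^m) ≺ f^*` by the
Berezin–Lieb inequality, and their squared norms are the integrals of `f` times its Berezin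
transform, which converge to `∫ f²` because the coherent states concentrate at points. Since
`‖f^* - g‖² ≤ ‖f^*‖² - ‖g‖²` for every decreasing step function `g ≺ f^*`, it follows that
`p^m(λ^m) → f^*`.
-/

namespace ToeplitzConvexity

/-! ### Majorization and integrals over sets -/

section Rearrangement

open ProbabilityTheory

variable {X : Type*} [MeasurableSpace X] {μ : Measure X} {g h : X → ℝ}

theorem setIntegral_le_measureReal_mul_add [IsFiniteMeasure μ] (hg : Integrable g μ) (A : Set X)
    (t : ℝ) : ∫ x in A, g x ∂μ ≤ μ.real A * t + ∫ x, max (g x - t) 0 ∂μ := by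
  have hsub : Integrable (fun x => g x - t) μ := hg.sub (integrable_const t)
  calc ∫ x in A, g x ∂μ
      = μ.real A * t + ∫ x in A, (g x - t) ∂μ := by
        rw [integral_sub hg.integrableOn (integrable_const t), setIntegral_const, smul_eq_mul]
        ring
    _ ≤ μ.real A * t + ∫ x in A, max (g x - t) 0 ∂μ := by
        gcongr μ.real A * t + ?_
        exact integral_mono hsub.integrableOn hsub.pos_part.integrableOn fun x => le_max_left _ _
    _ ≤ μ.real A * t + ∫ x, max (g x - t) 0 ∂μ := by
        gcongr μ.real A * t + ?_
        exact setIntegral_le_integral hsub.pos_part (ae_of_all _ fun x => le_max_right _ _)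

theorem setIntegral_eq_measureReal_mul_add [IsFiniteMeasure μ] (hg : Integrable g μ) {A : Set X}
    (hA : MeasurableSet A) {t : ℝ} (h_in : ∀ᵐ x ∂μ, x ∈ A → t ≤ g x)
    (h_out : ∀ᵐ x ∂μ, x ∉ A → g x ≤ t) :
    ∫ x in A, g x ∂μ = μ.real A * t + ∫ x, max (g x - t) 0 ∂μ := by
  have pos_part_eq : (fun x => max (g x - t) 0) =ᵐ[μ] A.indicator fun x => g x - t := by
    filter_upwards [h_in, h_out] with x hin hout
    by_cases hx : x ∈ A
    · rw [indicator_of_mem hx, max_eq_left (sub_nonneg.2 (hin hx))]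
    · rw [indicator_of_notMem hx, max_eq_right (sub_nonpos.2 (hout hx))]
  rw [integral_congr_ae pos_part_eq, integral_indicator hA,
    integral_sub hg.integrableOn (integrable_const t), setIntegral_const, smul_eq_mul]
  ring

variable [IsProbabilityMeasure μ]

theorem measureReal_univ_sub_distributionFunction (hg : AEMeasurable g μ) (t : ℝ) :
    μ.real univ - distributionFunction μ g t = (μ.map g).real (Ici t) := by
  have compl_superlevel : {x | g x < t} = (g ⁻¹' Ici t)ᶜ := by
    ext x
    simp
  rw [map_measureReal_apply_of_aemeasurable hg measurableSet_Ici, distributionFunction,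
    compl_superlevel, probReal_compl_eq_one_sub₀ (hg.nullMeasurableSet_preimage measurableSet_Ici),
    probReal_univ, sub_sub_cancel]

theorem decreasingRearrangement_eq_of_identDistrib {Y : Type*} [MeasurableSpace Y]
    {ν : Measure Y} [IsProbabilityMeasure ν] {k : Y → ℝ} (hgk : IdentDistrib g k μ ν) :
    decreasingRearrangement μ g = decreasingRearrangement ν k := by
  funext s
  simp only [decreasingRearrangement, hgk.map_eq,
    measureReal_univ_sub_distributionFunction hgk.aemeasurable_fst,
    measureReal_univ_sub_distributionFunction hgk.aemeasurable_snd]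

theorem le_sInf_measureReal_Ici_lt_iff (ν : Measure ℝ) [IsProbabilityMeasure ν] {s : ℝ}
    (hs : s ∈ Ioo (0 : ℝ) 1) (t : ℝ) :
    t ≤ sInf {t | ν.real (Ici t) < s} ↔ s ≤ ν.real (Ici t) := by
  have := Measure.isProbabilityMeasure_map (μ := ν) measurable_neg.aemeasurable
  have tail_eq_cdf (t : ℝ) : ν.real (Ici t) = cdf (ν.map Neg.neg) (-t) := by
    rw [cdf_eq_real, map_measureReal_apply measurable_neg measurableSet_Iic]
    simp
  simp only [tail_eq_cdf]
  set F := cdf (ν.map Neg.neg)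
  have lowerBound {b : ℝ} (hb : s ≤ F (-b)) : b ∈ lowerBounds {t | F (-t) < s} := fun u hu =>
    le_of_not_gt fun hub => (hb.trans (F.mono (neg_le_neg hub.le))).not_gt hu
  refine ⟨fun ht => ?_, fun ht => le_csInf ?_ (lowerBound ht)⟩
  · by_contra! hlt
    obtain ⟨u, hu, htu⟩ := (((F.right_continuous (-t)).mono Ioi_subset_Ici_self).eventually_lt_const
      hlt |>.and self_mem_nhdsWithin).exists
    obtain ⟨b, hb⟩ := ((tendsto_cdf_atTop (ν.map Neg.neg)).eventually_const_lt hs.2).exists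
    have : sInf {t | F (-t) < s} ≤ -u :=
      csInf_le ⟨-b, lowerBound (by rw [neg_neg]; exact hb.le)⟩ (by simpa using hu)
    exact ht.not_gt (this.trans_lt (neg_lt.1 htu))
  · obtain ⟨u, hu⟩ := ((tendsto_cdf_atBot (ν.map Neg.neg)).eventually_lt_const hs.1).exists
    exact ⟨-u, by simpa using hu⟩

theorem le_decreasingRearrangement_iff (hg : AEMeasurable g μ) {s : ℝ} (hs : s ∈ Ioo (0 : ℝ) 1)
    (t : ℝ) : t ≤ decreasingRearrangement μ g s ↔ s ≤ (μ.map g).real (Ici t) := by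
  have := Measure.isProbabilityMeasure_map hg
  simp only [decreasingRearrangement, measureReal_univ_sub_distributionFunction hg]
  exact le_sInf_measureReal_Ici_lt_iff _ hs t

theorem antitoneOn_decreasingRearrangement (hg : AEMeasurable g μ) :
    AntitoneOn (decreasingRearrangement μ g) (Ioo 0 1) := fun _ ha _ hb hab =>
  (le_decreasingRearrangement_iff hg ha _).2
    (hab.trans ((le_decreasingRearrangement_iff hg hb _).1 le_rfl))

/-- The decreasing rearrangement `g^*` as a function on the unit interval. At the endpoints it takes
the junk values of `sInf`, which do not matter up to null sets. -/
noncomputable def unitRearrangement (μ : Measure X) (g : X → ℝ) (s : I) : ℝ :=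
  decreasingRearrangement μ g s

theorem ae_mem_Ioo_unitInterval : ∀ᵐ s : I, s ∈ Ioo (0 : I) 1 := by
  filter_upwards [Measure.ae_ne volume (0 : I), Measure.ae_ne volume (1 : I)] with s hs0 hs1
  exact ⟨unitInterval.pos_iff_ne_zero.2 hs0, unitInterval.lt_one_iff_ne_one.2 hs1⟩

theorem antitoneOn_unitRearrangement (hg : AEMeasurable g μ) :
    AntitoneOn (unitRearrangement μ g) (Ioo 0 1) := fun _ ha _ hb hab =>
  antitoneOn_decreasingRearrangement hg ha hb hab

theorem identDistrib_unitRearrangement (hg : AEMeasurable g μ) :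
    IdentDistrib (unitRearrangement μ g) g volume μ := by
  have := Measure.isProbabilityMeasure_map hg
  have hmeas : AEMeasurable (unitRearrangement μ g) := by
    have := aemeasurable_restrict_of_antitoneOn (μ := (volume : Measure I)) measurableSet_Ioo
      (antitoneOn_unitRearrangement hg)
    rwa [Measure.restrict_eq_self_of_ae_mem ae_mem_Ioo_unitInterval] at this
  have := Measure.isProbabilityMeasure_map hmeas
  refine ⟨hmeas, hg, Measure.ext_of_Ici _ _ fun t => ?_⟩
  have superlevel_ae_eq : unitRearrangement μ g ⁻¹' Ici t =ᵐ[volume]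
      Iic (⟨(μ.map g).real (Ici t), measureReal_nonneg, measureReal_le_one⟩ : I) := by
    filter_upwards [ae_mem_Ioo_unitInterval] with s hs
    exact propext (le_decreasingRearrangement_iff hg hs t)
  rw [Measure.map_apply_of_aemeasurable hmeas measurableSet_Ici, measure_congr superlevel_ae_eq,
    unitInterval.volume_Iic, ofReal_measureReal]

theorem intervalIntegral_eq_setIntegral_Iio (φ : ℝ → ℝ) (s : I) :
    ∫ z in (0 : ℝ)..s, φ z = ∫ x : I in Iio s, φ x := by
  have preimage_eq : ((↑) : I → ℝ) ⁻¹' Iio (s : ℝ) = Iio s := rfl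
  rw [← preimage_eq, unitInterval.measurePreserving_coe.setIntegral_preimage_emb
    unitInterval.measurableEmbedding_coe, intervalIntegral.integral_of_le s.2.1,
    Measure.restrict_restrict measurableSet_Iio, integral_Ioc_eq_integral_Ioo,
    ← integral_Ico_eq_integral_Ioo]
  congr 2
  ext x
  simp only [mem_inter_iff, mem_Iio, mem_Icc, mem_Ico]
  grind [s.2.2]

theorem integral_decreasingRearrangement_eq_setIntegral (μ : Measure X) (g : X → ℝ) (s : I) :
    ∫ z in (0 : ℝ)..s, decreasingRearrangement μ g z = ∫ x in Iio s, unitRearrangement μ g x :=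
  intervalIntegral_eq_setIntegral_Iio _ s

theorem integral_decreasingRearrangement (hg : AEMeasurable g μ) :
    ∫ z in (0 : ℝ)..1, decreasingRearrangement μ g z = ∫ x, g x ∂μ := by
  rw [← (identDistrib_unitRearrangement hg).integral_eq, ← Icc.coe_one,
    integral_decreasingRearrangement_eq_setIntegral,
    Measure.restrict_eq_self_of_ae_mem (s := Iio (1 : I))
      (ae_mem_Ioo_unitInterval.mono fun _ hs => hs.2)]

theorem integral_pos_part_unitRearrangement (hg : AEMeasurable g μ) (t : ℝ) :
    ∫ s, max (unitRearrangement μ g s - t) 0 = ∫ x, max (g x - t) 0 ∂μ :=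
  ((identDistrib_unitRearrangement hg).comp (u := fun y : ℝ => max (y - t) 0)
    (by fun_prop)).integral_eq

theorem integrable_unitRearrangement (hg : Integrable g μ) : Integrable (unitRearrangement μ g) :=
  (identDistrib_unitRearrangement hg.1.aemeasurable).integrable_iff.2 hg

theorem measureReal_Iio_unitInterval (s : I) : (volume : Measure I).real (Iio s) = s := by
  simp [measureReal_def, s.2.1]

theorem integral_decreasingRearrangement_le (hg : Integrable g μ) (s : I) (t : ℝ) :
    ∫ z in (0 : ℝ)..s, decreasingRearrangement μ g z ≤ s * t + ∫ x, max (g x - t) 0 ∂μ := by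
  rw [integral_decreasingRearrangement_eq_setIntegral,
    ← integral_pos_part_unitRearrangement hg.1.aemeasurable]
  simpa only [measureReal_Iio_unitInterval] using
    setIntegral_le_measureReal_mul_add (integrable_unitRearrangement hg) (Iio s) t

theorem integral_decreasingRearrangement_eq (hg : Integrable g μ) {s : I} {t : ℝ}
    (h_lt : ∀ z ∈ Ioo (0 : I) 1, z < s → t ≤ unitRearrangement μ g z)
    (h_gt : ∀ z ∈ Ioo (0 : I) 1, s < z → unitRearrangement μ g z ≤ t) :
    ∫ z in (0 : ℝ)..s, decreasingRearrangement μ g z = s * t + ∫ x, max (g x - t) 0 ∂μ := by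
  rw [integral_decreasingRearrangement_eq_setIntegral,
    ← integral_pos_part_unitRearrangement hg.1.aemeasurable]
  have := setIntegral_eq_measureReal_mul_add (integrable_unitRearrangement hg)
    (measurableSet_Iio (a := s)) (ae_mem_Ioo_unitInterval.mono h_lt)
    (by filter_upwards [ae_mem_Ioo_unitInterval, Measure.ae_ne volume s] with z hz hzs hsz
        exact h_gt z hz ((not_lt.1 hsz).lt_of_ne' hzs))
  simpa only [measureReal_Iio_unitInterval] using this

theorem integral_decreasingRearrangement_eq_self (hg : Integrable g μ) {s : I}
    (hs : s ∈ Ioo (0 : I) 1) :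
    ∫ z in (0 : ℝ)..s, decreasingRearrangement μ g z =
      s * unitRearrangement μ g s + ∫ x, max (g x - unitRearrangement μ g s) 0 ∂μ := by
  have hanti := antitoneOn_unitRearrangement hg.1.aemeasurable
  exact integral_decreasingRearrangement_eq hg (fun z hz hzs => hanti hz hs hzs.le)
    fun z hz hsz => hanti hs hz hsz.le

theorem exists_integral_decreasingRearrangement_eq (hg : Integrable g μ) (t : ℝ) :
    ∃ s : I, ∫ z in (0 : ℝ)..s, decreasingRearrangement μ g z =
      s * t + ∫ x, max (g x - t) 0 ∂μ := by
  have := Measure.isProbabilityMeasure_map hg.1.aemeasurable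
  have le_iff {z : I} (hz : z ∈ Ioo (0 : I) 1) := le_decreasingRearrangement_iff (s := z)
    hg.1.aemeasurable hz t
  exact ⟨⟨(μ.map g).real (Ici t), measureReal_nonneg, measureReal_le_one⟩,
    integral_decreasingRearrangement_eq hg (fun z hz hzs => (le_iff hz).2 hzs.le)
      fun z hz hsz => le_of_lt (lt_of_not_ge fun hlt => ((le_iff hz).1 hlt).not_gt hsz)⟩

theorem setIntegral_le_integral_decreasingRearrangement (hg : Integrable g μ) {A : Set X}
    (hA : MeasurableSet A) :
    ∫ x in A, g x ∂μ ≤ ∫ z in (0 : ℝ)..μ.real A, decreasingRearrangement μ g z := by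
  rcases (measureReal_nonneg (μ := μ) (s := A)).eq_or_lt with hA0 | hA0
  · rw [← hA0, intervalIntegral.integral_same,
      setIntegral_measure_zero _ ((measureReal_eq_zero_iff).1 hA0.symm)]
  rcases (measureReal_le_one (μ := μ) (s := A)).eq_or_lt with hA1 | hA1
  · have ae_mem : ∀ᵐ x ∂μ, x ∈ A := by
      refine (mem_ae_iff_prob_eq_one hA).2 ?_
      rw [← ofReal_measureReal, hA1, ENNReal.ofReal_one]
    rw [hA1, integral_decreasingRearrangement hg.1.aemeasurable,
      Measure.restrict_eq_self_of_ae_mem ae_mem]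
  · let s : I := ⟨μ.real A, hA0.le, hA1.le⟩
    exact (setIntegral_le_measureReal_mul_add hg A (unitRearrangement μ g s)).trans_eq
      (integral_decreasingRearrangement_eq_self hg (s := s) ⟨hA0, hA1⟩).symm

theorem isMajorizedBy_iff (hg : Integrable g μ) (hh : Integrable h μ) :
    IsMajorizedBy μ g h ↔
      (∀ t, ∫ x, max (g x - t) 0 ∂μ ≤ ∫ x, max (h x - t) 0 ∂μ) ∧ ∫ x, g x ∂μ = ∫ x, h x ∂μ := by
  rw [IsMajorizedBy, integral_decreasingRearrangement hg.1.aemeasurable,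
    integral_decreasingRearrangement hh.1.aemeasurable]
  refine and_congr_left fun heq => ⟨fun hmaj t => ?_, fun hpos s hs => ?_⟩
  · obtain ⟨s, hs⟩ := exists_integral_decreasingRearrangement_eq hg t
    have partial_le : ∫ z in (0 : ℝ)..s, decreasingRearrangement μ g z ≤
        ∫ z in (0 : ℝ)..s, decreasingRearrangement μ h z := by
      rcases s.2.2.eq_or_lt with hs1 | hs1
      · rw [hs1, integral_decreasingRearrangement hg.1.aemeasurable,
          integral_decreasingRearrangement hh.1.aemeasurable, heq]
      · exact hmaj s ⟨s.2.1, hs1⟩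
    linarith [integral_decreasingRearrangement_le hh s t]
  · rcases hs.1.eq_or_lt with rfl | hs0
    · simp
    · lift s to I using ⟨hs.1, hs.2.le⟩
      rw [integral_decreasingRearrangement_eq_self hh ⟨hs0, hs.2⟩]
      exact (integral_decreasingRearrangement_le hg s _).trans (by gcongr _ + ?_; exact hpos _)

end Rearrangement

section Majorized

open ProbabilityTheory

variable {X : Type*} [MeasurableSpace X] {μ : Measure X} {f g h : X → ℝ}

/-- The set `Ω(f^*)` of the square-integrable functions on the unit interval that are majorized by
a function `f` on an arbitrary probability space; `majorizedSet` is the case of `CP1`. -/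
def majorized (μ : Measure X) (f : X → ℝ) : Set L2I :=
  {g | IsMajorizedBy (volume : Measure I) g (unitRearrangement μ f)}

theorem mem_majorized_congr {g h : L2I} (hgh : IdentDistrib g h) :
    g ∈ majorized μ f ↔ h ∈ majorized μ f := by
  simp only [majorized, IsMajorizedBy, mem_ofPred_eq,
    decreasingRearrangement_eq_of_identDistrib hgh]

theorem identDistrib_compMeasurePreserving {φ : I → I} (hφ : MeasurePreserving φ volume volume)
    (g : L2I) : IdentDistrib (Lp.compMeasurePreserving φ hφ g) g := by
  have hg := (Lp.stronglyMeasurable g).measurable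
  refine (IdentDistrib.of_ae_eq (Lp.stronglyMeasurable _).measurable.aemeasurable
    (Lp.coeFn_compMeasurePreserving g hφ)).trans
    ⟨(hg.comp hφ.measurable).aemeasurable, hg.aemeasurable, ?_⟩
  rw [← Measure.map_map hg hφ.measurable, hφ.map_eq]

theorem compMeasurePreserving_mem_majorized_iff {φ : I → I} (hφ : MeasurePreserving φ volume volume)
    {g : L2I} :
    Lp.compMeasurePreserving φ hφ g ∈ majorized μ f ↔ g ∈ majorized μ f :=
  mem_majorized_congr (identDistrib_compMeasurePreserving hφ g)

variable [IsProbabilityMeasure μ]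

theorem isMajorizedBy_iff_setIntegral_le (hgm : Measurable g) (hg : Integrable g μ)
    (hh : Integrable h μ) :
    IsMajorizedBy μ g h ↔
      (∀ A, MeasurableSet A →
        ∫ x in A, g x ∂μ ≤ ∫ z in (0 : ℝ)..μ.real A, decreasingRearrangement μ h z) ∧
      ∫ x, g x ∂μ = ∫ x, h x ∂μ := by
  refine ⟨fun hmaj => ?_, fun ⟨hA, heq⟩ => (isMajorizedBy_iff hg hh).2 ⟨fun t => ?_, heq⟩⟩
  · refine ⟨fun A hA => (setIntegral_le_integral_decreasingRearrangement hg hA).trans ?_,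
      ((isMajorizedBy_iff hg hh).1 hmaj).2⟩
    rcases (measureReal_le_one (μ := μ) (s := A)).eq_or_lt with hA1 | hA1
    · rw [hA1, hmaj.2]
    · exact hmaj.1 _ ⟨measureReal_nonneg, hA1⟩
  · have hmeas : MeasurableSet {x | t ≤ g x} := measurableSet_le measurable_const hgm
    have superlevel := setIntegral_eq_measureReal_mul_add hg hmeas (t := t)
      (ae_of_all _ fun _ => id) (ae_of_all _ fun _ hx => (not_le.1 hx).le)
    have := integral_decreasingRearrangement_le hh
      ⟨μ.real {x | t ≤ g x}, measureReal_nonneg, measureReal_le_one⟩ t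
    linarith [hA _ hmeas]

theorem integrable_coeFn_L2I (g : L2I) : Integrable g :=
  (Lp.memLp g).integrable one_le_two

theorem mem_majorized_iff (hf : Integrable f μ) {g : L2I} :
    g ∈ majorized μ f ↔ (∀ t, ∫ x, max (g x - t) 0 ≤ ∫ x, max (f x - t) 0 ∂μ) ∧
      ∫ x, g x = ∫ x, f x ∂μ := by
  rw [majorized, mem_ofPred_eq, isMajorizedBy_iff (integrable_coeFn_L2I g)
    (integrable_unitRearrangement hf),
    (identDistrib_unitRearrangement hf.1.aemeasurable).integral_eq]
  simp only [integral_pos_part_unitRearrangement hf.1.aemeasurable]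

theorem mem_majorized_iff_setIntegral_le (hf : Integrable f μ) {g : L2I} :
    g ∈ majorized μ f ↔
      (∀ A, MeasurableSet A → ∫ x in A, g x ≤
        ∫ z in (0 : ℝ)..volume.real A, decreasingRearrangement μ f z) ∧
      ∫ x, g x = ∫ x, f x ∂μ := by
  rw [majorized, mem_ofPred_eq, isMajorizedBy_iff_setIntegral_le
    (Lp.stronglyMeasurable g).measurable (integrable_coeFn_L2I g) (integrable_unitRearrangement hf),
    (identDistrib_unitRearrangement hf.1.aemeasurable).integral_eq,
    decreasingRearrangement_eq_of_identDistrib (identDistrib_unitRearrangement hf.1.aemeasurable)]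

theorem majorized_eq_inter_halfSpaces (hf : Integrable f μ) :
    majorized μ f =
      (⋂ (A : Set I) (hA : MeasurableSet A),
        {g | inner ℝ (indicatorConstLp 2 hA (measure_ne_top volume A) 1) g ≤
          ∫ z in (0 : ℝ)..volume.real A, decreasingRearrangement μ f z}) ∩
      {g | inner ℝ (indicatorConstLp 2 MeasurableSet.univ (measure_ne_top volume univ) 1) g =
        ∫ x, f x ∂μ} := by
  ext g
  simp only [mem_majorized_iff_setIntegral_le hf, L2.inner_indicatorConstLp_one, setIntegral_univ,
    mem_inter_iff, mem_iInter, mem_ofPred_eq]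

theorem isClosed_majorized (hf : Integrable f μ) : IsClosed (majorized μ f) := by
  rw [majorized_eq_inter_halfSpaces hf]
  exact (isClosed_iInter fun A => isClosed_iInter fun hA =>
    isClosed_le (by fun_prop) continuous_const).inter (isClosed_eq (by fun_prop) continuous_const)

theorem convex_majorized (hf : Integrable f μ) : Convex ℝ (majorized μ f) := by
  rw [majorized_eq_inter_halfSpaces hf]
  exact (convex_iInter₂ fun A hA => convex_halfSpace_le (innerₛₗ ℝ _).isLinear _).inter
    (convex_hyperplane (innerₛₗ ℝ _).isLinear _)

theorem memLp_unitRearrangement (hf : MemLp f 2 μ) : MemLp (unitRearrangement μ f) 2 :=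
  (identDistrib_unitRearrangement hf.1.aemeasurable).memLp_iff.2 hf

/-- The decreasing rearrangement `f^*` as an element of `L²([0,1])`. -/
noncomputable def rearrangementLp (hf : MemLp f 2 μ) : L2I :=
  (memLp_unitRearrangement hf).toLp (unitRearrangement μ f)

theorem identDistrib_rearrangementLp (hf : MemLp f 2 μ) :
    IdentDistrib (rearrangementLp hf) f volume μ :=
  (IdentDistrib.of_ae_eq (Lp.aestronglyMeasurable _).aemeasurable
    (memLp_unitRearrangement hf).coeFn_toLp).trans
    (identDistrib_unitRearrangement hf.1.aemeasurable)

theorem rearrangementLp_mem_majorized (hf : MemLp f 2 μ) : rearrangementLp hf ∈ majorized μ f := by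
  have := decreasingRearrangement_eq_of_identDistrib ((identDistrib_rearrangementLp hf).trans
    (identDistrib_unitRearrangement hf.1.aemeasurable).symm)
  simp only [majorized, IsMajorizedBy, mem_ofPred_eq, this, le_refl, implies_true, and_self]

/-- The set `Smeas(I) · f^*` of the compositions of `f^*` with the (not necessarily invertible)
measure preserving maps of the unit interval, for a function `f` on an arbitrary probability space;
`smeasOrbit` is the case of `CP1`. -/
def rearrangementOrbit (hf : MemLp f 2 μ) : Set L2I :=
  {g | ∃ (φ : I → I) (hφ : MeasurePreserving φ volume volume),
    g = Lp.compMeasurePreserving φ hφ (rearrangementLp hf)}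

theorem rearrangementOrbit_subset_majorized (hf : MemLp f 2 μ) :
    rearrangementOrbit hf ⊆ majorized μ f := by
  rintro _ ⟨φ, hφ, rfl⟩
  exact (compMeasurePreserving_mem_majorized_iff hφ).2 (rearrangementLp_mem_majorized hf)

end Majorized

section TopLimsup

theorem weakClosure_eq_self {K : Set L2I} (hconv : Convex ℝ K) (hclosed : IsClosed K) :
    weakClosure K = K := by
  rw [weakClosure, ← hconv.toWeakSpace_closure ℝ, hclosed.closure_eq,
    (toWeakSpace ℝ L2I).injective.preimage_image]

variable {X : Type*} [TopologicalSpace X] {E : ℕ → Set X}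

theorem topLimsup_subset {K : Set X} (hK : IsClosed K) (hE : ∀ m, E m ⊆ K) : topLimsup E ⊆ K := by
  intro x hx
  by_contra hxK
  obtain ⟨m, y, hy, hyE⟩ := (hx Kᶜ (hK.isOpen_compl.mem_nhds hxK)).nonempty
  exact hy (hE m hyE)

theorem mem_topLimsup_of_tendsto {x : X} {u : ℕ → X} (huE : ∀ m, u m ∈ E m)
    (hu : Tendsto u atTop (𝓝 x)) : x ∈ topLimsup E := fun V hV => by
  rw [← Nat.frequently_atTop_iff_infinite]
  exact ((hu.eventually_mem hV).mono fun m hm => ⟨u m, hm, huE m⟩).frequently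

end TopLimsup

/-! ### Permutohedra and step functions -/

section Permutohedron

theorem last_mul_sum_le_sum_mul {n : ℕ} {c d : Fin (n + 1) → ℝ} (hc : Antitone c)
    (hd : ∀ k, 0 ≤ ∑ j ∈ Finset.Iio k, d j) : c (Fin.last n) * ∑ j, d j ≤ ∑ j, c j * d j := by
  induction n with
  | zero => simp
  | succ n ih =>
    have initial_nonneg : 0 ≤ ∑ j : Fin (n + 1), d j.castSucc := by
      simpa [Fin.Iio_last_eq_map] using hd (Fin.last _)
    have initial_le := ih (c := c ∘ Fin.castSucc) (d := d ∘ Fin.castSucc)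
      (hc.comp_monotone Fin.castSuccOrderEmb.monotone) fun k => by
        simpa [← Fin.map_castSuccEmb_Iio] using hd k.castSucc
    have last_le : c (Fin.last _) ≤ c (Fin.last n).castSucc := hc (Fin.le_last _)
    rw [Fin.sum_univ_castSucc, Fin.sum_univ_castSucc (fun j => c j * d j), mul_add]
    gcongr ?_ + _
    exact (mul_le_mul_of_nonneg_right last_le initial_nonneg).trans initial_le

variable {m : ℕ} {a b c : Fin (m + 1) → ℝ}

theorem sum_mul_le_sum_mul_of_antitone (hc : Antitone c)
    (hab : ∀ k, ∑ j ∈ Finset.Iio k, a j ≤ ∑ j ∈ Finset.Iio k, b j) (heq : ∑ j, a j = ∑ j, b j) :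
    ∑ j, c j * a j ≤ ∑ j, c j * b j := by
  have := last_mul_sum_le_sum_mul hc (d := b - a) (by simpa using hab)
  simpa [mul_sub, heq] using this

/-- Rado's theorem. -/
theorem mem_permutohedron_of_sum_le
    (hab : ∀ (S : Finset (Fin (m + 1))) (k : Fin (m + 1)), S.card = k →
      ∑ j ∈ S, a j ≤ ∑ j ∈ Finset.Iio k, b j)
    (heq : ∑ j, a j = ∑ j, b j) : a ∈ permutohedron b := by
  by_contra hmem
  obtain ⟨φ, u, hφb, hφa⟩ := geometric_hahn_banach_closed_point (convex_convexHull ℝ _)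
    ((finite_range fun τ : Equiv.Perm (Fin (m + 1)) => b ∘ τ).isClosed_convexHull ℝ) hmem
  obtain ⟨c, hφ⟩ : ∃ c : Fin (m + 1) → ℝ, ∀ x, φ x = ∑ i, c i * x i :=
    ⟨_, fun x => by
      simpa [mul_comm] using LinearMap.pi_apply_eq_sum_univ (φ : (Fin (m + 1) → ℝ) →ₗ[ℝ] ℝ) x⟩
  obtain ⟨τ, hτ⟩ : ∃ τ : Equiv.Perm (Fin (m + 1)), Antitone (c ∘ τ) :=
    ⟨Tuple.sort (-c), fun i j hij => neg_le_neg_iff.1 (Tuple.monotone_sort (-c) hij)⟩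
  have sorted_le : ∑ j, c (τ j) * a (τ j) ≤ ∑ j, c (τ j) * b j :=
    sum_mul_le_sum_mul_of_antitone hτ (a := a ∘ τ)
      (fun k => by simpa using hab ((Finset.Iio k).map τ.toEmbedding) k (by simp))
      (by rw [← heq]; exact Equiv.sum_comp τ a)
  have φa_le : φ a ≤ φ (b ∘ τ.symm) := by
    rw [hφ, hφ, ← Equiv.sum_comp τ, ← Equiv.sum_comp τ (fun i => c i * (b ∘ τ.symm) i)]
    simpa using sorted_le
  exact (hφa.trans_le φa_le).not_gt (hφb _ (subset_convexHull ℝ _ ⟨τ.symm, rfl⟩))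

end Permutohedron

section StepInterval

/-- The index `k` of the step interval `[k/(m+1), (k+1)/(m+1))` that contains `x`; the minimum
assigns the point `1`, which lies in no step interval, to the last one. -/
noncomputable def stepIndex (m : ℕ) (x : I) : Fin (m + 1) :=
  ⟨min ⌊((m : ℝ) + 1) * x⌋₊ m, Nat.lt_succ_of_le (min_le_right _ _)⟩

variable {m : ℕ} {k : Fin (m + 1)}

theorem measurable_stepIndex : Measurable (stepIndex m) :=
  (measurable_from_nat (f := fun n => (⟨min n m, by lia⟩ : Fin (m + 1)))).comp
    (Nat.measurable_floor.comp (by fun_prop))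

theorem mem_stepInterval_iff_floor_eq {x : I} :
    x ∈ stepInterval m k ↔ ⌊((m : ℝ) + 1) * x⌋₊ = k := by
  rw [Nat.floor_eq_iff (mul_nonneg (by positivity) x.2.1), stepInterval, mem_ofPred_eq,
    div_le_iff₀' (by positivity), lt_div_iff₀' (by positivity)]

theorem stepIndex_eq_of_mem {x : I} (hx : x ∈ stepInterval m k) : stepIndex m x = k := by
  ext
  simp only [stepIndex, mem_stepInterval_iff_floor_eq.1 hx, Nat.le_of_lt_succ k.2, min_eq_left]

theorem mem_stepInterval_stepIndex {x : I} (hx : x < 1) : x ∈ stepInterval m (stepIndex m x) := by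
  have floor_lt : ⌊((m : ℝ) + 1) * x⌋₊ < m + 1 := by
    rw [Nat.floor_lt (mul_nonneg (by positivity) x.2.1)]
    push_cast
    exact mul_lt_of_lt_one_right (by positivity) hx
  exact mem_stepInterval_iff_floor_eq.2 (min_eq_left (Nat.le_of_lt_succ floor_lt)).symm

theorem ae_mem_stepInterval_stepIndex (m : ℕ) : ∀ᵐ x : I, x ∈ stepInterval m (stepIndex m x) := by
  filter_upwards [ae_mem_Ioo_unitInterval] with x hx using mem_stepInterval_stepIndex hx.2

theorem pairwise_disjoint_stepInterval (m : ℕ) :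
    Pairwise (Function.onFun Disjoint (stepInterval m)) :=
  fun _ _ hij => disjoint_left.2 fun _ hi hj =>
    hij ((stepIndex_eq_of_mem hi).symm.trans (stepIndex_eq_of_mem hj))

theorem sum_restrict_stepInterval (m : ℕ) :
    ∑ k, (volume : Measure I).restrict (stepInterval m k) = volume := by
  have iUnion_ae_eq_univ : (⋃ k, stepInterval m k) =ᵐ[volume] (univ : Set I) :=
    eventuallyEq_univ.2 <| (ae_mem_stepInterval_stepIndex m).mono fun _ => mem_iUnion_of_mem _
  rw [← Measure.sum_fintype, ← Measure.restrict_iUnion (pairwise_disjoint_stepInterval m)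
    (measurableSet_stepInterval m), Measure.restrict_congr_set iUnion_ae_eq_univ,
    Measure.restrict_univ]

theorem map_coe_restrict_stepInterval (k : Fin (m + 1)) :
    ((volume : Measure I).restrict (stepInterval m k)).map (↑) =
      (volume : Measure ℝ).restrict (Ico ((k : ℝ) / (m + 1)) ((k + 1) / (m + 1))) := by
  have Ico_subset : Ico ((k : ℝ) / (m + 1)) ((k + 1) / (m + 1)) ⊆ I := fun y hy => by
    refine ⟨le_trans (by positivity) hy.1, hy.2.le.trans (div_le_one_of_le₀ ?_ (by positivity))⟩
    exact_mod_cast k.2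
  rw [← Measure.restrict_restrict_of_subset Ico_subset]
  exact (unitInterval.measurePreserving_coe.restrict_preimage measurableSet_Ico).map_eq

theorem measureReal_stepInterval (k : Fin (m + 1)) :
    (volume : Measure I).real (stepInterval m k) = 1 / (m + 1) := by
  rw [← measureReal_restrict_apply_univ, ← preimage_univ (f := ((↑) : I → ℝ)),
    ← map_measureReal_apply measurable_subtype_coe .univ, map_coe_restrict_stepInterval,
    measureReal_restrict_apply_univ, Real.volume_real_Ico_of_le (by gcongr; linarith)]
  ring

end StepInterval

section IntervalPerm

variable {m : ℕ} {k : Fin (m + 1)} {τ : Equiv.Perm (Fin (m + 1))}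

/-- The map of the unit interval that translates the `k`-th step interval to the `τ k`-th one;
the projection onto the unit interval only matters at the point `1`. -/
noncomputable def intervalPerm (m : ℕ) (τ : Equiv.Perm (Fin (m + 1))) (x : I) : I :=
  projIcc 0 1 zero_le_one (x + ((τ (stepIndex m x) : ℝ) - stepIndex m x) / (m + 1))

theorem measurable_intervalPerm (τ : Equiv.Perm (Fin (m + 1))) : Measurable (intervalPerm m τ) :=
  continuous_projIcc.measurable.comp <| measurable_subtype_coe.add <|
    (measurable_from_top (f := fun k : Fin (m + 1) => ((τ k : ℝ) - k) / (m + 1))).comp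
      measurable_stepIndex

theorem coe_intervalPerm_of_mem {x : I} (hx : x ∈ stepInterval m k) :
    (intervalPerm m τ x : ℝ) = x + ((τ k : ℝ) - k) / (m + 1) := by
  obtain ⟨le_x, x_lt⟩ := id hx
  have τk_le : ((τ k : ℝ) + 1) / (m + 1) ≤ 1 :=
    div_le_one_of_le₀ (mod_cast (τ k).2) (by positivity)
  have τk_nonneg : (0 : ℝ) ≤ (τ k : ℝ) / (m + 1) := by positivity
  rw [add_div] at x_lt τk_le
  rw [intervalPerm, stepIndex_eq_of_mem hx, sub_div, projIcc_of_mem]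
  constructor <;> linarith

theorem intervalPerm_mem_stepInterval {x : I} (hx : x ∈ stepInterval m k) :
    intervalPerm m τ x ∈ stepInterval m (τ k) := by
  obtain ⟨le_x, x_lt⟩ := id hx
  rw [add_div] at x_lt
  simp only [stepInterval, mem_ofPred_eq, coe_intervalPerm_of_mem hx, sub_div, add_div]
  constructor <;> linarith

theorem map_intervalPerm_restrict_stepInterval (τ : Equiv.Perm (Fin (m + 1))) (k : Fin (m + 1)) :
    (volume.restrict (stepInterval m k)).map (intervalPerm m τ) =
      volume.restrict (stepInterval m (τ k)) := by
  have translate : ((volume : Measure I).restrict (stepInterval m k)).map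
      (fun x => (intervalPerm m τ x : ℝ)) =
      (((volume : Measure I).restrict (stepInterval m k)).map (↑)).map
        (· + ((τ k : ℝ) - k) / (m + 1)) := by
    rw [Measure.map_map (by fun_prop) measurable_subtype_coe]
    exact Measure.map_congr <| (ae_restrict_mem (measurableSet_stepInterval m k)).mono
      fun x hx => coe_intervalPerm_of_mem hx
  have preimage_Ico : Ico ((k : ℝ) / (m + 1)) ((k + 1) / (m + 1)) =
      (· + ((τ k : ℝ) - k) / (m + 1)) ⁻¹' Ico ((τ k : ℝ) / (m + 1)) ((τ k + 1) / (m + 1)) := by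
    rw [preimage_add_const_Ico]
    congr 1 <;> ring
  apply unitInterval.measurableEmbedding_coe.map_injective
  rw [Measure.map_map measurable_subtype_coe (measurable_intervalPerm τ),
    map_coe_restrict_stepInterval]
  refine translate.trans ?_
  rw [map_coe_restrict_stepInterval, preimage_Ico]
  exact ((measurePreserving_add_right volume _).restrict_preimage measurableSet_Ico).map_eq

theorem measurePreserving_intervalPerm (τ : Equiv.Perm (Fin (m + 1))) :
    MeasurePreserving (intervalPerm m τ) volume volume := by
  refine ⟨measurable_intervalPerm τ, ?_⟩
  conv_lhs => rw [← sum_restrict_stepInterval m]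
  simp only [← Measure.mapₗ_apply_of_measurable (measurable_intervalPerm τ), map_sum]
  simp only [Measure.mapₗ_apply_of_measurable (measurable_intervalPerm τ),
    map_intervalPerm_restrict_stepInterval]
  rw [Equiv.sum_comp τ fun k => (volume : Measure I).restrict (stepInterval m k),
    sum_restrict_stepInterval]

end IntervalPerm

section StepMap

variable {m : ℕ}

theorem coeFn_stepMap (a : Fin (m + 1) → ℝ) :
    stepMap m a =ᵐ[volume] fun x => a (stepIndex m x) := by
  have indicator_coeFn : ∀ᵐ x : I, ∀ k, indicatorConstLp 2 (measurableSet_stepInterval m k)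
      (measure_ne_top volume _) (a k) x = (stepInterval m k).indicator (fun _ => a k) x :=
    ae_all_iff.2 fun k => indicatorConstLp_coeFn
  filter_upwards [indicator_coeFn, ae_mem_stepInterval_stepIndex m, Lp.coeFn_finsetSum Finset.univ
    fun k => indicatorConstLp 2 (measurableSet_stepInterval m k) (measure_ne_top volume _) (a k)]
    with x hx hmem hsum
  rw [stepMap, hsum, Finset.sum_apply, Finset.sum_eq_single (stepIndex m x)]
  · rw [hx, indicator_of_mem hmem]
  · intro k _ hk
    rw [hx, indicator_of_notMem fun hx => hk (stepIndex_eq_of_mem hx).symm]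
  · simp

/-- The map `p^m : ℝ^{m+1} → L²([0,1])` as a linear map. -/
noncomputable def stepLinearMap (m : ℕ) : (Fin (m + 1) → ℝ) →ₗ[ℝ] L2I where
  toFun := stepMap m
  map_add' a b := by
    refine Lp.ext ?_
    filter_upwards [coeFn_stepMap (a + b), coeFn_stepMap a, coeFn_stepMap b,
      Lp.coeFn_add (stepMap m a) (stepMap m b)] with x hab ha hb hadd
    rw [hab, hadd, Pi.add_apply, Pi.add_apply, ha, hb]
  map_smul' r a := by
    refine Lp.ext ?_
    filter_upwards [coeFn_stepMap (r • a), coeFn_stepMap a,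
      Lp.coeFn_smul r (stepMap m a)] with x hra ha hsmul
    rw [hra, RingHom.id_apply, hsmul, Pi.smul_apply, Pi.smul_apply, ha]

theorem setIntegral_comp_stepMap (u : ℝ → ℝ) (a : Fin (m + 1) → ℝ) (k : Fin (m + 1)) :
    ∫ x in stepInterval m k, u (stepMap m a x) = u (a k) / (m + 1) := by
  rw [setIntegral_congr_ae (g := fun _ => u (a k)) (measurableSet_stepInterval m k),
    setIntegral_const, measureReal_stepInterval, smul_eq_mul, one_div_mul_eq_div]
  filter_upwards [coeFn_stepMap a] with x hx hk
  rw [hx, stepIndex_eq_of_mem hk]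

theorem integral_comp_stepMap (u : ℝ → ℝ) (a : Fin (m + 1) → ℝ) :
    ∫ x, u (stepMap m a x) = (∑ k, u (a k)) / (m + 1) := by
  have integrableOn (k : Fin (m + 1)) :
      IntegrableOn (fun x => u (stepMap m a x)) (stepInterval m k) := by
    refine (integrableOn_const (C := u (a k))).congr_fun_ae ?_
    filter_upwards [ae_restrict_of_ae (coeFn_stepMap a),
      ae_restrict_mem (measurableSet_stepInterval m k)] with x hx hk
    rw [hx, stepIndex_eq_of_mem hk]
  have := integral_finsetSum_measure fun k (_ : k ∈ Finset.univ) => integrableOn k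
  rw [sum_restrict_stepInterval] at this
  simp only [this, setIntegral_comp_stepMap, Finset.sum_div]

theorem compMeasurePreserving_stepMap (τ : Equiv.Perm (Fin (m + 1))) (a : Fin (m + 1) → ℝ) :
    Lp.compMeasurePreserving (intervalPerm m τ) (measurePreserving_intervalPerm τ) (stepMap m a) =
      stepMap m (a ∘ τ) := by
  have hφ := measurePreserving_intervalPerm τ
  refine Lp.ext ?_
  filter_upwards [Lp.coeFn_compMeasurePreserving (stepMap m a) hφ,
    hφ.quasiMeasurePreserving.ae_eq_comp (coeFn_stepMap a), coeFn_stepMap (a ∘ τ),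
    ae_mem_stepInterval_stepIndex m] with x hcomp ha haτ hx
  rw [hcomp, ha, haτ, Function.comp_apply, Function.comp_apply,
    stepIndex_eq_of_mem (intervalPerm_mem_stepInterval hx)]

end StepMap

section StepAverage

variable {m : ℕ}

/-- The vector of the averages of `g` over the step intervals. -/
noncomputable def stepAverage (m : ℕ) (g : I → ℝ) (k : Fin (m + 1)) : ℝ :=
  (m + 1) * ∫ x in stepInterval m k, g x

theorem stepAverage_stepMap (a : Fin (m + 1) → ℝ) : stepAverage m (stepMap m a) = a := by
  ext k
  have := setIntegral_comp_stepMap id a k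
  simp only [id] at this
  rw [stepAverage, this, mul_div_cancel₀ _ (by positivity)]

theorem inner_stepMap (a : Fin (m + 1) → ℝ) (g : L2I) :
    inner ℝ (stepMap m a) g = (∑ k, a k * stepAverage m g k) / (m + 1) := by
  rw [stepMap, sum_inner, Finset.sum_div]
  refine Finset.sum_congr rfl fun k _ => ?_
  rw [L2.inner_indicatorConstLp_eq_inner_setIntegral, stepAverage, real_inner_eq_re_inner]
  simp only [RCLike.inner_apply, conj_trivial, RCLike.re_to_real]
  field_simp

theorem norm_sub_stepMap_stepAverage_le (g : L2I) (c : Fin (m + 1) → ℝ) :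
    ‖g - stepMap m (stepAverage m g)‖ ≤ ‖g - stepMap m c‖ := by
  have orthogonal :
      inner ℝ (g - stepMap m (stepAverage m g)) (stepMap m (stepAverage m g - c)) = 0 := by
    rw [real_inner_comm, inner_sub_right, inner_stepMap, inner_stepMap, stepAverage_stepMap,
      sub_self]
  have sub_eq : g - stepMap m c =
      g - stepMap m (stepAverage m g) + stepMap m (stepAverage m g - c) := by
    change g - stepLinearMap m c = g - stepLinearMap m _ + stepLinearMap m (_ - c)
    rw [map_sub]
    abel
  have pythagoras := norm_add_sq_eq_norm_sq_add_norm_sq_real orthogonal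
  rw [← sub_eq] at pythagoras
  exact (mul_self_le_mul_self_iff (norm_nonneg _) (norm_nonneg _)).2
    (pythagoras ▸ le_add_of_nonneg_right (mul_self_nonneg _))

theorem eventually_exists_norm_toLp_sub_stepMap_le (h : C(I, ℝ)) {ε : ℝ} (hε : 0 < ε) :
    ∀ᶠ m in atTop, ∃ c, ‖ContinuousMap.toLp 2 (volume : Measure I) ℝ h - stepMap m c‖ ≤ ε := by
  obtain ⟨δ, hδ, h_dist⟩ := Metric.uniformContinuous_iff.1
    (CompactSpace.uniformContinuous_of_continuous h.continuous) ε hε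
  filter_upwards [tendsto_one_div_add_atTop_nhds_zero_nat.eventually_lt_const hδ] with m hm
  let leftEnd (k : Fin (m + 1)) : I := ⟨(k : ℝ) / (m + 1), by positivity,
    div_le_one_of_le₀ (mod_cast k.2.le) (by positivity)⟩
  refine ⟨fun k => h (leftEnd k), (Lp.norm_le_of_ae_bound hε.le ?_).trans_eq
    (b := (measureUnivNNReal (volume : Measure I) : ℝ) ^ (2 : ℝ≥0∞).toReal⁻¹ * ε) ?_⟩
  · filter_upwards [ContinuousMap.coeFn_toLp (p := 2) (𝕜 := ℝ) (volume : Measure I) h,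
      Lp.coeFn_sub (ContinuousMap.toLp 2 volume ℝ h) (stepMap m fun k => h (leftEnd k)),
      coeFn_stepMap fun k => h (leftEnd k), ae_mem_stepInterval_stepIndex m]
      with x h_coe h_sub h_step ⟨left_le, lt_right⟩
    rw [h_sub, Pi.sub_apply, h_coe, h_step, ← dist_eq_norm]
    refine (h_dist ?_).le
    rw [Subtype.dist_eq, Real.dist_eq, abs_of_nonneg (sub_nonneg.2 left_le)]
    rw [add_div] at lt_right
    linarith
  · simp [measureUnivNNReal]

theorem tendsto_stepMap_stepAverage (g : L2I) :
    Tendsto (fun m => stepMap m (stepAverage m g)) atTop (𝓝 g) := by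
  rw [Metric.tendsto_nhds]
  intro ε hε
  obtain ⟨h, hh⟩ := Metric.denseRange_iff.1
    (ContinuousMap.toLp_denseRange ℝ (volume : Measure I) (p := 2) ℝ (by norm_num)) g (ε / 2)
    (half_pos hε)
  filter_upwards [eventually_exists_norm_toLp_sub_stepMap_le h (half_pos hε)] with m ⟨c, hc⟩
  rw [dist_eq_norm] at hh
  rw [dist_comm, dist_eq_norm]
  calc ‖g - stepMap m (stepAverage m g)‖ ≤ ‖g - stepMap m c‖ := norm_sub_stepMap_stepAverage_le g c
    _ ≤ ‖g - ContinuousMap.toLp 2 volume ℝ h‖ + ‖ContinuousMap.toLp 2 volume ℝ h - stepMap m c‖ :=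
      norm_sub_le_norm_sub_add_norm_sub _ _ _
    _ < ε := by linarith

theorem sum_stepAverage {g : I → ℝ} (hg : Integrable g) (S : Finset (Fin (m + 1))) :
    ∑ k ∈ S, stepAverage m g k = (m + 1) * ∫ x in ⋃ k ∈ S, stepInterval m k, g x := by
  rw [integral_biUnion_finset S (fun k _ => measurableSet_stepInterval m k)
    ((pairwise_disjoint_stepInterval m).set_pairwise _) (fun k _ => hg.integrableOn),
    Finset.mul_sum]
  rfl

theorem measureReal_biUnion_stepInterval (S : Finset (Fin (m + 1))) :
    (volume : Measure I).real (⋃ k ∈ S, stepInterval m k) = S.card / (m + 1) := by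
  rw [measureReal_biUnion_finset ((pairwise_disjoint_stepInterval m).set_pairwise _)
    (fun k _ => measurableSet_stepInterval m k)]
  simp only [measureReal_stepInterval, Finset.sum_const, nsmul_eq_mul, mul_one_div]

end StepAverage

section MajorizedPermutohedron

variable {X : Type*} [MeasurableSpace X] {μ : Measure X} [IsProbabilityMeasure μ] {f : X → ℝ}
  {m : ℕ}

theorem biUnion_Iio_stepInterval (k : Fin (m + 1)) (hk : (k : ℝ) / (m + 1) ∈ I) :
    ⋃ j ∈ Finset.Iio k, stepInterval m j = Iio (⟨(k : ℝ) / (m + 1), hk⟩ : I) := by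
  ext x
  simp only [Finset.mem_Iio, mem_iUnion, exists_prop, mem_Iio]
  refine ⟨fun ⟨j, hjk, hx⟩ => hx.2.trans_le ?_, fun hx => ?_⟩
  · have : ((j : ℕ) : ℝ) + 1 ≤ (k : ℕ) := mod_cast hjk
    simp only
    gcongr
  · have hmem := mem_stepInterval_stepIndex (m := m) (hx.trans_le (unitInterval.le_one _))
    refine ⟨_, ?_, hmem⟩
    have := hmem.1.trans_lt (show (x : ℝ) < k / (m + 1) from hx)
    exact_mod_cast (div_lt_div_iff_of_pos_right (by positivity)).1 this

theorem sum_Iio_stepAverage_rearrangementLp (hf : MemLp f 2 μ) (k : Fin (m + 1)) :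
    ∑ j ∈ Finset.Iio k, stepAverage m (rearrangementLp hf) j =
      (m + 1) * ∫ z in (0 : ℝ)..k / (m + 1), decreasingRearrangement μ f z := by
  have hk : (k : ℝ) / (m + 1) ∈ I :=
    ⟨by positivity, div_le_one_of_le₀ (mod_cast k.2.le) (by positivity)⟩
  rw [sum_stepAverage (integrable_coeFn_L2I _), biUnion_Iio_stepInterval k hk, rearrangementLp,
    integral_congr_ae (ae_restrict_of_ae (memLp_unitRearrangement hf).coeFn_toLp),
    ← integral_decreasingRearrangement_eq_setIntegral]

theorem sum_stepAverage_le_of_mem_majorized (hf : MemLp f 2 μ) {g : L2I} (hg : g ∈ majorized μ f)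
    {S : Finset (Fin (m + 1))} {k : Fin (m + 1)} (hS : S.card = k) :
    ∑ j ∈ S, stepAverage m g j ≤ ∑ j ∈ Finset.Iio k, stepAverage m (rearrangementLp hf) j := by
  rw [sum_stepAverage (integrable_coeFn_L2I g), sum_Iio_stepAverage_rearrangementLp, ← hS,
    ← measureReal_biUnion_stepInterval]
  gcongr
  exact ((mem_majorized_iff_setIntegral_le (hf.integrable one_le_two)).1 hg).1 _
    (S.measurableSet_biUnion fun j _ => measurableSet_stepInterval m j)

theorem sum_stepAverage_eq_of_mem_majorized (hf : MemLp f 2 μ) {g : L2I}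
    (hg : g ∈ majorized μ f) : ∑ j, stepAverage m g j = (m + 1) * ∫ x, f x ∂μ := by
  simp only [stepAverage]
  rw [← Finset.mul_sum, ← integral_finsetSum_measure fun k _ => (integrable_coeFn_L2I g).restrict,
    sum_restrict_stepInterval, ((mem_majorized_iff (hf.integrable one_le_two)).1 hg).2]

theorem stepAverage_mem_permutohedron (hf : MemLp f 2 μ) {g : L2I} (hg : g ∈ majorized μ f) :
    stepAverage m g ∈ permutohedron (stepAverage m (rearrangementLp hf)) :=
  mem_permutohedron_of_sum_le (fun _ _ hS => sum_stepAverage_le_of_mem_majorized hf hg hS) <| by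
    rw [sum_stepAverage_eq_of_mem_majorized hf hg,
      sum_stepAverage_eq_of_mem_majorized hf (rearrangementLp_mem_majorized hf)]

theorem image_permutohedron_subset_majorized (hf : Integrable f μ) {a : Fin (m + 1) → ℝ}
    (ha : stepMap m a ∈ majorized μ f) : stepMap m '' permutohedron a ⊆ majorized μ f := by
  refine image_subset_iff.2 <|
    convexHull_min ?_ ((convex_majorized hf).linear_preimage (stepLinearMap m))
  rintro _ ⟨τ, rfl⟩
  change stepMap m (a ∘ τ) ∈ majorized μ f
  rwa [← compMeasurePreserving_stepMap, compMeasurePreserving_mem_majorized_iff]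

open scoped Pointwise in
theorem exists_norm_stepMap_sub_le {K : Set L2I} (hK : Convex ℝ K) {v : L2I}
    (hv : ∀ τ, Lp.compMeasurePreserving (intervalPerm m τ) (measurePreserving_intervalPerm τ) v ∈ K)
    {a b : Fin (m + 1) → ℝ} (ha : a ∈ permutohedron b) :
    ∃ u ∈ K, ‖stepMap m a - u‖ ≤ ‖stepMap m b - v‖ := by
  set δ := ‖stepMap m b - v‖
  have permutohedron_subset :
      permutohedron b ⊆ stepLinearMap m ⁻¹' (K + Metric.closedBall (0 : L2I) δ) := by
    refine convexHull_min ?_ ((hK.add (convex_closedBall 0 δ)).linear_preimage (stepLinearMap m))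
    rintro _ ⟨τ, rfl⟩
    refine ⟨_, hv τ, stepMap m (b ∘ τ) - _, ?_, add_sub_cancel _ _⟩
    rw [mem_closedBall_zero_iff, ← compMeasurePreserving_stepMap, ← map_sub,
      Lp.norm_compMeasurePreserving]
  obtain ⟨u, hu, w, hw, huw⟩ := permutohedron_subset ha
  refine ⟨u, hu, ?_⟩
  rw [show stepMap m a = u + w from huw.symm, add_sub_cancel_left]
  exact mem_closedBall_zero_iff.1 hw

theorem exists_tendsto_of_mem_majorized (hf : MemLp f 2 μ) {K : ℕ → Set L2I}
    (hK : ∀ m, Convex ℝ (K m)) {v : ℕ → L2I} (hv : Tendsto v atTop (𝓝 (rearrangementLp hf)))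
    (hvK : ∀ m τ, Lp.compMeasurePreserving (intervalPerm m τ) (measurePreserving_intervalPerm τ)
      (v m) ∈ K m) {g : L2I} (hg : g ∈ majorized μ f) :
    ∃ u : ℕ → L2I, (∀ m, u m ∈ K m) ∧ Tendsto u atTop (𝓝 g) := by
  choose u huK hu using fun m =>
    exists_norm_stepMap_sub_le (hK m) (hvK m) (stepAverage_mem_permutohedron hf hg)
  have error_tendsto : Tendsto (fun m => stepMap m (stepAverage m g) - u m) atTop (𝓝 0) :=
    squeeze_zero_norm hu <| by
      simpa using ((tendsto_stepMap_stepAverage (rearrangementLp hf)).sub hv).norm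
  exact ⟨u, huK, by simpa using (tendsto_stepMap_stepAverage g).sub error_tendsto⟩

theorem closedConvexHull_rearrangementOrbit (hf : MemLp f 2 μ) :
    closedConvexHull ℝ (rearrangementOrbit hf) = majorized μ f := by
  have hint := hf.integrable one_le_two
  refine (closedConvexHull_min (rearrangementOrbit_subset_majorized hf) (convex_majorized hint)
    (isClosed_majorized hint)).antisymm fun g hg => ?_
  obtain ⟨u, hu, hug⟩ := exists_tendsto_of_mem_majorized hf
    (K := fun _ => convexHull ℝ (rearrangementOrbit hf)) (fun _ => convex_convexHull ℝ _)
    tendsto_const_nhds (fun m τ => subset_convexHull ℝ _ ⟨_, measurePreserving_intervalPerm τ, rfl⟩)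
    hg
  rw [closedConvexHull_eq_closure_convexHull]
  exact mem_closure_of_tendsto hug (Eventually.of_forall hu)

theorem norm_rearrangementLp_sub_stepMap_sq_le (hf : MemLp f 2 μ) {l : Fin (m + 1) → ℝ}
    (hl : Antitone l) (hmem : stepMap m l ∈ majorized μ f) :
    ‖rearrangementLp hf - stepMap m l‖ ^ 2 ≤ ‖rearrangementLp hf‖ ^ 2 - ‖stepMap m l‖ ^ 2 := by
  have abel : ∑ j, l j * l j ≤ ∑ j, l j * stepAverage m (rearrangementLp hf) j := by
    refine sum_mul_le_sum_mul_of_antitone hl (fun k => ?_) ?_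
    · simpa only [stepAverage_stepMap] using
        sum_stepAverage_le_of_mem_majorized hf hmem (Fin.card_Iio k)
    · simpa only [stepAverage_stepMap,
        sum_stepAverage_eq_of_mem_majorized hf (rearrangementLp_mem_majorized hf)] using
        sum_stepAverage_eq_of_mem_majorized (m := m) hf hmem
  have norm_sq_le_inner : ‖stepMap m l‖ ^ 2 ≤ inner ℝ (rearrangementLp hf) (stepMap m l) := by
    rw [← real_inner_self_eq_norm_sq, real_inner_comm _ (rearrangementLp hf), inner_stepMap,
      inner_stepMap, stepAverage_stepMap]
    gcongr
  rw [norm_sub_sq_real]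
  linarith

theorem norm_rearrangementLp_sq (hf : MemLp f 2 μ) :
    ‖rearrangementLp hf‖ ^ 2 = ∫ x, f x ^ 2 ∂μ := by
  rw [← real_inner_self_eq_norm_sq, L2.inner_def]
  simp only [real_inner_self_eq_norm_sq, Real.norm_eq_abs, sq_abs]
  exact ((identDistrib_rearrangementLp hf).comp (u := fun y => y ^ 2) (by fun_prop)).integral_eq

theorem norm_stepMap_sq (a : Fin (m + 1) → ℝ) :
    ‖stepMap m a‖ ^ 2 = (∑ k, a k ^ 2) / (m + 1) := by
  rw [← real_inner_self_eq_norm_sq, inner_stepMap, stepAverage_stepMap]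
  simp only [sq]

theorem topLimsup_image_permutohedron (hf : MemLp f 2 μ) {l : ∀ m : ℕ, Fin (m + 1) → ℝ}
    (hl : ∀ m, Antitone (l m)) (hmem : ∀ m, stepMap m (l m) ∈ majorized μ f)
    (hlim : Tendsto (fun m : ℕ => (∑ k, l m k ^ 2) / (m + 1)) atTop (𝓝 (∫ x, f x ^ 2 ∂μ))) :
    topLimsup (fun m => stepMap m '' permutohedron (l m)) = majorized μ f := by
  have hint := hf.integrable one_le_two
  have norm_sq_tendsto :
      Tendsto (fun m => ‖rearrangementLp hf - stepMap m (l m)‖ ^ 2) atTop (𝓝 0) := by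
    refine squeeze_zero (fun m => sq_nonneg _)
      (fun m => norm_rearrangementLp_sub_stepMap_sq_le hf (hl m) (hmem m)) ?_
    simp only [norm_rearrangementLp_sq, norm_stepMap_sq]
    rw [← sub_self (∫ x, f x ^ 2 ∂μ)]
    exact hlim.const_sub _
  have stepMap_tendsto : Tendsto (fun m => stepMap m (l m)) atTop (𝓝 (rearrangementLp hf)) := by
    rw [tendsto_iff_norm_sub_tendsto_zero]
    simpa [norm_sub_rev] using norm_sq_tendsto.sqrt
  refine (topLimsup_subset (isClosed_majorized hint) fun m =>
    image_permutohedron_subset_majorized hint (hmem m)).antisymm fun g hg => ?_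
  obtain ⟨u, hu, hug⟩ := exists_tendsto_of_mem_majorized hf
    (K := fun m => stepMap m '' permutohedron (l m))
    (fun m => (convex_convexHull ℝ _).linear_image (stepLinearMap m)) stepMap_tendsto
    (fun m τ => ⟨l m ∘ τ, subset_convexHull ℝ _ ⟨τ, rfl⟩, (compMeasurePreserving_stepMap τ _).symm⟩)
    hg
  exact mem_topLimsup_of_tendsto hu hug

end MajorizedPermutohedron

section SmoothFunction

variable {f : CP1 → ℝ}

theorem mk_eq_affineChart {v : Fin 2 → ℂ} (hv : v ≠ 0) (h : v 0 ≠ 0) :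
    (Projectivization.mk ℂ v hv : CP1) = affineChart (v 1 / v 0) := by
  refine (Projectivization.mk_eq_mk_iff' _ _ _ _ _).2 ⟨v 0, ?_⟩
  ext i
  fin_cases i
  · simp
  · simp [mul_div_cancel₀, h]

theorem mk_eq_affineChartInfty {v : Fin 2 → ℂ} (hv : v ≠ 0) (h : v 1 ≠ 0) :
    (Projectivization.mk ℂ v hv : CP1) = affineChartInfty (v 0 / v 1) := by
  refine (Projectivization.mk_eq_mk_iff' _ _ _ _ _).2 ⟨v 1, ?_⟩
  ext i
  fin_cases i
  · simp [mul_div_cancel₀, h]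
  · simp

theorem continuousAt_of_eq_comp_coordinate_div {g : {v : Fin 2 → ℂ // v ≠ 0} → ℝ} {u : ℂ → ℝ}
    (hu : Continuous u) {i j : Fin 2} (hg : ∀ v, v.1 j ≠ 0 → g v = u (v.1 i / v.1 j))
    {v : {v : Fin 2 → ℂ // v ≠ 0}} (hv : v.1 j ≠ 0) : ContinuousAt g v := by
  have continuous_coordinate (k : Fin 2) :
      Continuous fun v : {v : Fin 2 → ℂ // v ≠ 0} => v.1 k :=
    (continuous_apply k).comp continuous_subtype_val
  have hdiv : ContinuousAt (fun v : {v : Fin 2 → ℂ // v ≠ 0} => u (v.1 i / v.1 j)) v :=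
    hu.continuousAt.comp (f := fun v : {v : Fin 2 → ℂ // v ≠ 0} => v.1 i / v.1 j)
      ((continuous_coordinate i).continuousAt.div (continuous_coordinate j).continuousAt hv)
  refine hdiv.congr ?_
  filter_upwards [(continuous_coordinate j).continuousAt.eventually_ne hv] with v hv
  exact (hg v hv).symm

theorem IsSmooth.continuous (hf : IsSmooth f) : Continuous f := by
  refine continuous_coinduced_dom.2 (continuous_iff_continuousAt.2 fun v => ?_)
  by_cases hv0 : v.1 0 = 0
  · have hv1 : v.1 1 ≠ 0 := fun hv1 => v.2 (funext (Fin.forall_fin_two.2 ⟨hv0, hv1⟩))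
    exact continuousAt_of_eq_comp_coordinate_div hf.2.continuous
      (fun v hv => congrArg f (mk_eq_affineChartInfty v.2 hv)) hv1
  · exact continuousAt_of_eq_comp_coordinate_div hf.1.continuous
      (fun v hv => congrArg f (mk_eq_affineChart v.2 hv)) hv0

theorem IsSmooth.memLp (hf : IsSmooth f) (p : ℝ≥0∞) : MemLp f p areaMeasure := by
  obtain ⟨C, -, hC⟩ := hf.bounded
  exact MemLp.of_bound hf.continuous.measurable.aestronglyMeasurable C (Eventually.of_forall hC)

end SmoothFunction

section RadialIntegral

variable {m j : ℕ}

/-- The integral `∫₀^∞ tʲ / (1 + t)^(m + 2) dt`, written in the variable `r` with `t = r²`. It is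
the squared norm of the section `w ^ j` of `L^{⊗m}`, up to the angular factor `2π`. -/
noncomputable def radialIntegral (m j : ℕ) : ℝ :=
  ∫ r in Ioi (0 : ℝ), r * (2 * (r ^ 2) ^ j / (1 + r ^ 2) ^ (m + 2))

theorem pow_div_one_add_pow_le_one {t : ℝ} (ht : 0 ≤ t) (hj : j ≤ m) :
    t ^ j / (1 + t) ^ m ≤ 1 := by
  rw [div_le_one (by positivity)]
  calc t ^ j ≤ (1 + t) ^ j := by gcongr; linarith
    _ ≤ (1 + t) ^ m := pow_le_pow_right₀ (by linarith) hj

theorem integrableOn_radialIntegral (hj : j ≤ m) :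
    IntegrableOn (fun r : ℝ => r * (2 * (r ^ 2) ^ j / (1 + r ^ 2) ^ (m + 2))) (Ioi 0) := by
  refine integrable_and_integral_radial.1.mono' (by fun_prop) ?_
  filter_upwards [ae_restrict_mem measurableSet_Ioi] with r hr
  have hr : 0 < r := hr
  rw [Real.norm_of_nonneg (by positivity)]
  calc r * (2 * (r ^ 2) ^ j / (1 + r ^ 2) ^ (m + 2))
      = r * (2 / (1 + r ^ 2) ^ 2) * ((r ^ 2) ^ j / (1 + r ^ 2) ^ m) := by
        rw [pow_add]
        field_simp
    _ ≤ r * (2 / (1 + r ^ 2) ^ 2) :=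
        mul_le_of_le_one_right (by positivity) (pow_div_one_add_pow_le_one (sq_nonneg r) hj)

theorem hasDerivAt_pow_div_one_add_pow (m j : ℕ) (r : ℝ) :
    HasDerivAt (fun r : ℝ => (r ^ 2) ^ (j + 1) / (1 + r ^ 2) ^ (m + 1))
      (((j : ℝ) + 1) * (r * (2 * (r ^ 2) ^ j / (1 + r ^ 2) ^ (m + 2))) -
        ((m : ℝ) - j) * (r * (2 * (r ^ 2) ^ (j + 1) / (1 + r ^ 2) ^ (m + 2)))) r := by
  have hsq : HasDerivAt (fun r : ℝ => r ^ 2) (2 * r) r := by simpa using hasDerivAt_pow 2 r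
  refine ((hsq.fun_pow (j + 1)).fun_div ((hsq.const_add 1).fun_pow (m + 1))
    (by positivity)).congr_deriv ?_
  simp only [Nat.add_sub_cancel, Nat.cast_add, Nat.cast_one]
  field_simp
  ring

theorem tendsto_pow_div_one_add_pow_atTop (hj : j ≤ m) :
    Tendsto (fun r : ℝ => (r ^ 2) ^ j / (1 + r ^ 2) ^ (m + 1)) atTop (𝓝 0) := by
  have inv_tendsto : Tendsto (fun r : ℝ => (1 + r ^ 2)⁻¹) atTop (𝓝 0) :=
    (tendsto_atTop_add_const_left _ _ (tendsto_pow_atTop two_ne_zero)).inv_tendsto_atTop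
  refine squeeze_zero (fun r => by positivity) (fun r => ?_) inv_tendsto
  rw [pow_succ (1 + r ^ 2) m, ← div_div, div_eq_mul_inv]
  exact mul_le_of_le_one_left (by positivity) (pow_div_one_add_pow_le_one (sq_nonneg r) hj)

theorem succ_mul_radialIntegral (hj : j < m) :
    ((j : ℝ) + 1) * radialIntegral m j = ((m : ℝ) - j) * radialIntegral m (j + 1) := by
  have hint := (integrableOn_radialIntegral hj.le).const_mul ((j : ℝ) + 1)
  have hint_succ := (integrableOn_radialIntegral (j := j + 1) hj).const_mul ((m : ℝ) - j)
  have hderiv := hasDerivAt_pow_div_one_add_pow m j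
  have integral_deriv := integral_Ioi_of_hasDerivAt_of_tendsto (a := 0)
    (hderiv 0).continuousAt.continuousWithinAt (fun r _ => hderiv r)
    (hint.sub hint_succ) (tendsto_pow_div_one_add_pow_atTop (j := j + 1) hj)
  rw [integral_sub hint hint_succ, integral_const_mul, integral_const_mul, zero_pow two_ne_zero,
    zero_pow j.succ_ne_zero, zero_div, sub_zero] at integral_deriv
  exact sub_eq_zero.1 integral_deriv

theorem choose_mul_radialIntegral_eq_radialIntegral_zero (hj : j ≤ m) :
    m.choose j * radialIntegral m j = radialIntegral m 0 := by
  induction j with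
  | zero => rw [Nat.choose_zero_right, Nat.cast_one, one_mul]
  | succ i ih =>
    rw [← ih (by lia)]
    have choose_succ : (m.choose (i + 1) : ℝ) * (i + 1) = m.choose i * (m - i) := by
      rw [← Nat.cast_sub (by lia)]
      exact_mod_cast Nat.choose_succ_right_eq m i
    refine mul_left_cancel₀ (show (i : ℝ) + 1 ≠ 0 by positivity) ?_
    linear_combination radialIntegral m (i + 1) * choose_succ -
      m.choose i * succ_mul_radialIntegral (m := m) (j := i) hj

theorem sum_choose_mul_radialIntegral (m : ℕ) :
    ∑ j ∈ Finset.range (m + 1), m.choose j * radialIntegral m j = 1 := by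
  simp only [radialIntegral, ← integral_const_mul]
  rw [← integral_finsetSum _ fun j hj => (integrableOn_radialIntegral
    (Finset.mem_range_succ_iff.1 hj)).const_mul _]
  refine Eq.trans ?_ integrable_and_integral_radial.2
  refine setIntegral_congr_fun measurableSet_Ioi fun r _ => ?_
  have binomial :
      (1 + r ^ 2) ^ m = ∑ j ∈ Finset.range (m + 1), (r ^ 2) ^ j * (m.choose j : ℝ) := by
    rw [add_comm, add_pow]
    simp only [one_pow, mul_one]
  calc ∑ j ∈ Finset.range (m + 1), (m.choose j : ℝ) *
        (r * (2 * (r ^ 2) ^ j / (1 + r ^ 2) ^ (m + 2)))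
      = r * (2 * (1 + r ^ 2) ^ m / (1 + r ^ 2) ^ (m + 2)) := by
        rw [binomial, Finset.mul_sum, Finset.sum_div, Finset.mul_sum]
        exact Finset.sum_congr rfl fun j _ => by ring
    _ = r * (2 / (1 + r ^ 2) ^ 2) := by
        rw [pow_add]
        field_simp

theorem choose_mul_radialIntegral (hj : j ≤ m) :
    ((m : ℝ) + 1) * (m.choose j * radialIntegral m j) = 1 := by
  have hsum := sum_choose_mul_radialIntegral m
  rw [Finset.sum_congr rfl fun i hi =>
      choose_mul_radialIntegral_eq_radialIntegral_zero (Finset.mem_range_succ_iff.1 hi),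
    Finset.sum_const, Finset.card_range, nsmul_eq_mul, Nat.cast_add_one] at hsum
  rw [choose_mul_radialIntegral_eq_radialIntegral_zero hj, hsum]

end RadialIntegral

/-! ### Holomorphic sections and coherent states -/

section SectionMeasure

variable {E : Type*} [NormedAddCommGroup E] [NormedSpace ℝ E]

theorem integral_fubiniStudy (u : ℂ → E) :
    ∫ w, u w ∂fubiniStudy = ∫ w, (2 / (1 + ‖w‖ ^ 2) ^ 2) • u w := by
  rw [fubiniStudy, integral_withDensity_eq_integral_toReal_smul
    measurable_fubiniStudy_density (by simp)]
  refine integral_congr_ae (Eventually.of_forall fun w => ?_)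
  simp only
  rw [ENNReal.toReal_ofReal (by positivity)]

theorem integral_sectionMeasure (m : ℕ) (u : ℂ → E) :
    ∫ w, u w ∂sectionMeasure m = ∫ w, (1 / (1 + ‖w‖ ^ 2) ^ m) • u w ∂fubiniStudy := by
  rw [sectionMeasure, integral_withDensity_eq_integral_toReal_smul (by fun_prop) (by simp)]
  refine integral_congr_ae (Eventually.of_forall fun w => ?_)
  simp only
  rw [ENNReal.toReal_ofReal (by positivity)]

theorem integral_sectionMeasure_eq_volume (m : ℕ) (u : ℂ → E) :
    ∫ w, u w ∂sectionMeasure m = ∫ w, (2 / (1 + ‖w‖ ^ 2) ^ (m + 2)) • u w := by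
  rw [integral_sectionMeasure, integral_fubiniStudy]
  refine integral_congr_ae (Eventually.of_forall fun w => ?_)
  simp only
  rw [smul_smul, pow_add]
  congr 1
  field_simp

theorem integral_sectionMeasure_comp_rotation (m : ℕ) (a : Circle) (u : ℂ → E) :
    ∫ w, u (a * w) ∂sectionMeasure m = ∫ w, u w ∂sectionMeasure m := by
  rw [integral_sectionMeasure_eq_volume, integral_sectionMeasure_eq_volume]
  simpa only [rotation_apply, norm_mul, Circle.norm_coe, one_mul] using
    (rotation a).measurePreserving.integral_comp
      (rotation a).toHomeomorph.measurableEmbedding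
      fun w => (2 / (1 + ‖w‖ ^ 2) ^ (m + 2)) • u w

theorem integral_sectionMeasure_eq_zero (m : ℕ) {u : ℂ → ℂ} {a : Circle} {ζ : ℂ} (hζ : ζ ≠ 1)
    (hu : ∀ w, u (a * w) = ζ * u w) : ∫ w, u w ∂sectionMeasure m = 0 := by
  have invariant := integral_sectionMeasure_comp_rotation m a u
  simp only [hu, integral_const_mul] at invariant
  by_contra hne
  exact hζ (mul_eq_right₀ hne |>.1 invariant)

theorem norm_sq_eq_integral_sectionMeasure {m : ℕ} (s : L2Sections m) :
    ‖s‖ ^ 2 = ∫ z, ‖s z‖ ^ 2 ∂sectionMeasure m := by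
  refine Complex.ofReal_injective ?_
  rw [← integral_complex_ofReal, Complex.ofReal_pow]
  refine (inner_self_eq_norm_sq_to_K (𝕜 := ℂ) s).symm.trans ?_
  rw [L2.inner_def]
  simp only [inner_self_eq_norm_sq_to_K, Complex.ofReal_pow, Complex.coe_algebraMap]

end SectionMeasure

section MonomialSection

variable {m : ℕ}

/-- The reciprocal `(m + 1) / 2π · binom(m, k)` of the squared norm of the section `w ^ k` of
`L^{⊗m}`. -/
noncomputable def monomialWeight (m k : ℕ) : ℝ := ((m : ℝ) + 1) / (2 * Real.pi) * m.choose k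

theorem integral_norm_sq_pow_sectionMeasure (m k : ℕ) :
    ∫ w, (‖w‖ ^ 2) ^ k ∂sectionMeasure m = 2 * Real.pi * radialIntegral m k := by
  rw [integral_sectionMeasure_eq_volume, integral_fun_norm_addHaar (volume : Measure ℂ)
    fun r : ℝ => (2 / (1 + r ^ 2) ^ (m + 2)) • (r ^ 2) ^ k, Complex.finrank_real_complex,
    measureReal_def, Complex.volume_ball]
  have radial : ∫ r in Ioi (0 : ℝ), r ^ (2 - 1) • (2 / (1 + r ^ 2) ^ (m + 2)) • (r ^ 2) ^ k =
      radialIntegral m k := by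
    refine setIntegral_congr_fun measurableSet_Ioi fun r _ => ?_
    simp only [smul_eq_mul]
    ring
  rw [radial]
  simp [mul_assoc]

theorem monomialWeight_mul_integral_norm_sq_pow {k : ℕ} (hk : k ≤ m) :
    monomialWeight m k * ∫ w, (‖w‖ ^ 2) ^ k ∂sectionMeasure m = 1 := by
  have hpi := Real.pi_ne_zero
  rw [integral_norm_sq_pow_sectionMeasure, monomialWeight]
  refine Eq.trans ?_ (choose_mul_radialIntegral hk)
  field_simp

theorem inner_monomialSection_eq_integral (j k : Fin (m + 1)) :
    inner ℂ (monomialSection m j) (monomialSection m k) =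
      ∫ w : ℂ, (starRingEnd ℂ) w ^ (j : ℕ) * w ^ (k : ℕ) ∂sectionMeasure m := by
  rw [L2.inner_def]
  refine integral_congr_ae ?_
  filter_upwards [(memLp_monomial m j).coeFn_toLp, (memLp_monomial m k).coeFn_toLp] with w hj hk
  rw [monomialSection, monomialSection, hj, hk, RCLike.inner_apply, map_pow, mul_comm]

theorem monomialWeight_mul_inner_monomialSection_self (k : Fin (m + 1)) :
    monomialWeight m k * inner ℂ (monomialSection m k) (monomialSection m k) = 1 := by
  have conj_pow_mul_pow (w : ℂ) : (starRingEnd ℂ) w ^ (k : ℕ) * w ^ (k : ℕ) =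
      (((‖w‖ ^ 2) ^ (k : ℕ) : ℝ) : ℂ) := by
    rw [← mul_pow, Complex.conj_mul', Complex.ofReal_pow, Complex.ofReal_pow]
  simp only [inner_monomialSection_eq_integral, conj_pow_mul_pow]
  rw [integral_complex_ofReal, ← Complex.ofReal_mul,
    monomialWeight_mul_integral_norm_sq_pow k.is_le, Complex.ofReal_one]

theorem exists_circle_conj_pow_mul_pow_eq_neg_one {j k : ℕ} (hjk : j ≠ k) :
    ∃ a : Circle, (starRingEnd ℂ) (a : ℂ) ^ j * (a : ℂ) ^ k = -1 := by
  have hne : (k : ℂ) - j ≠ 0 := sub_ne_zero.2 (Nat.cast_injective.ne hjk.symm)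
  refine ⟨Circle.exp (Real.pi / ((k : ℝ) - j)), ?_⟩
  rw [Circle.coe_exp, ← Complex.exp_conj, ← Complex.exp_nat_mul, ← Complex.exp_nat_mul,
    ← Complex.exp_add, ← Complex.exp_pi_mul_I]
  congr 1
  simp only [map_mul, Complex.conj_I, Complex.conj_ofReal]
  push_cast
  field_simp
  ring

theorem inner_monomialSection_of_ne {j k : Fin (m + 1)} (hjk : j ≠ k) :
    inner ℂ (monomialSection m j) (monomialSection m k) = 0 := by
  obtain ⟨a, ha⟩ := exists_circle_conj_pow_mul_pow_eq_neg_one (Fin.val_injective.ne hjk)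
  rw [inner_monomialSection_eq_integral]
  refine integral_sectionMeasure_eq_zero m (a := a) (ζ := -1) (by norm_num) fun w => ?_
  rw [← ha, map_mul, mul_pow, mul_pow]
  ring

theorem coeFn_sum_smul_monomialSection (c : Fin (m + 1) → ℂ) :
    ((∑ k, c k • monomialSection m k : L2Sections m) : ℂ → ℂ) =ᵐ[sectionMeasure m]
      fun w => ∑ k : Fin (m + 1), c k * w ^ (k : ℕ) := by
  have coeFn_smul (k : Fin (m + 1)) :
      ((c k • monomialSection m k : L2Sections m) : ℂ → ℂ) =ᵐ[sectionMeasure m]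
        fun w => c k * w ^ (k : ℕ) := by
    filter_upwards [Lp.coeFn_smul (c k) (monomialSection m k),
      (memLp_monomial m k).coeFn_toLp] with w hsmul hmonomial
    rw [hsmul, Pi.smul_apply, monomialSection, hmonomial, smul_eq_mul]
  filter_upwards [ae_all_iff.2 coeFn_smul, Lp.coeFn_finsetSum Finset.univ
    (fun k => c k • monomialSection m k)] with w hsmul hsum
  rw [hsum, Finset.sum_apply]
  exact Finset.sum_congr rfl fun k _ => hsmul k

end MonomialSection

section CoherentState

variable (m : ℕ)

/-- The holomorphic section `z ↦ (m + 1) / 2π · (1 + w̄ z)^m` of `L^{⊗m}`, which represents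
evaluation at `w` on the space of holomorphic sections. -/
noncomputable def coherentState (w : ℂ) : holSections m :=
  ∑ k : Fin (m + 1), ((monomialWeight m k : ℂ) * (starRingEnd ℂ) w ^ (k : ℕ)) •
    ⟨monomialSection m k, Submodule.subset_span ⟨k, rfl⟩⟩

theorem coe_coherentState (w : ℂ) : (coherentState m w : L2Sections m) =
    ∑ k : Fin (m + 1), ((monomialWeight m k : ℂ) * (starRingEnd ℂ) w ^ (k : ℕ)) •
      monomialSection m k := by
  simp only [coherentState, Submodule.coe_sum, Submodule.coe_smul]

theorem inner_coherentState_monomialSection (w : ℂ) (k : Fin (m + 1)) :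
    inner ℂ (coherentState m w : L2Sections m) (monomialSection m k) = w ^ (k : ℕ) := by
  rw [coe_coherentState, sum_inner, Finset.sum_eq_single k]
  · rw [inner_smul_left, map_mul, Complex.conj_ofReal, map_pow, Complex.conj_conj]
    linear_combination w ^ (k : ℕ) * monomialWeight_mul_inner_monomialSection_self k
  · intro j _ hjk
    rw [inner_smul_left, inner_monomialSection_of_ne hjk, mul_zero]
  · exact fun hk => absurd (Finset.mem_univ k) hk

theorem inner_coherentState_sum (w : ℂ) (c : Fin (m + 1) → ℂ) :
    inner ℂ (coherentState m w : L2Sections m) (∑ k, c k • monomialSection m k) =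
      ∑ k : Fin (m + 1), c k * w ^ (k : ℕ) := by
  simp only [inner_sum, inner_smul_right, inner_coherentState_monomialSection]

theorem ae_eq_inner_coherentState (s : holSections m) :
    ∀ᵐ w ∂sectionMeasure m, (s : L2Sections m) w = inner ℂ (coherentState m w) s := by
  obtain ⟨c, hc⟩ := (Submodule.mem_span_range_iff_exists_fun ℂ).1 s.2
  filter_upwards [coeFn_sum_smul_monomialSection c] with w hw
  rw [Submodule.coe_inner, ← hc, inner_coherentState_sum, hw]

theorem sum_monomialWeight_mul_pow (z : ℂ) :
    ∑ k : Fin (m + 1), (monomialWeight m k : ℂ) * z ^ (k : ℕ) =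
      (((m : ℝ) + 1) / (2 * Real.pi) : ℝ) * (1 + z) ^ m := by
  rw [Fin.sum_univ_eq_sum_range (fun k => (monomialWeight m k : ℂ) * z ^ k), add_comm 1 z, add_pow,
    Finset.mul_sum]
  refine Finset.sum_congr rfl fun k _ => ?_
  rw [monomialWeight]
  push_cast
  ring

theorem inner_coherentState_coherentState (w z : ℂ) :
    inner ℂ (coherentState m w) (coherentState m z) =
      (((m : ℝ) + 1) / (2 * Real.pi) : ℝ) * (1 + (starRingEnd ℂ) z * w) ^ m := by
  rw [Submodule.coe_inner, coe_coherentState m z, inner_coherentState_sum,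
    ← sum_monomialWeight_mul_pow]
  exact Finset.sum_congr rfl fun k _ => by rw [mul_pow, mul_assoc]

theorem norm_coherentState_sq (w : ℂ) :
    ‖coherentState m w‖ ^ 2 = ((m : ℝ) + 1) / (2 * Real.pi) * (1 + ‖w‖ ^ 2) ^ m := by
  have inner_self := inner_self_eq_norm_sq_to_K (𝕜 := ℂ) (coherentState m w)
  rw [inner_coherentState_coherentState, Complex.conj_mul'] at inner_self
  refine Complex.ofReal_injective ?_
  push_cast at inner_self ⊢
  exact inner_self.symm

end CoherentState

/-! ### The Berezin transform -/

section PlaneAreaMeasure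

/-- The normalized area measure `Ω / 2π` in the affine coordinate. -/
noncomputable def planeAreaMeasure : Measure ℂ :=
  ENNReal.ofReal (1 / (2 * Real.pi)) • fubiniStudy

theorem map_planeAreaMeasure : planeAreaMeasure.map affineChart = areaMeasure := by
  rw [planeAreaMeasure, Measure.map_smul, areaMeasure]

instance : IsProbabilityMeasure planeAreaMeasure :=
  have : IsProbabilityMeasure (planeAreaMeasure.map affineChart) :=
    map_planeAreaMeasure ▸ inferInstance
  Measure.isProbabilityMeasure_of_map affineChart

theorem integral_areaMeasure {u : CP1 → ℝ} (hu : Continuous u) :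
    ∫ p, u p ∂areaMeasure = ∫ w, u (affineChart w) ∂planeAreaMeasure := by
  rw [← map_planeAreaMeasure, integral_map continuous_affineChart.measurable.aemeasurable
    hu.measurable.aestronglyMeasurable]

theorem integral_sectionMeasure_eq_planeAreaMeasure (m : ℕ) (u : ℂ → ℝ) :
    ∫ w, u w ∂sectionMeasure m =
      2 * Real.pi * ∫ w, 1 / (1 + ‖w‖ ^ 2) ^ m * u w ∂planeAreaMeasure := by
  rw [integral_sectionMeasure, planeAreaMeasure, integral_smul_measure,
    ENNReal.toReal_ofReal (by positivity), smul_eq_mul]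
  simp only [smul_eq_mul]
  field_simp

end PlaneAreaMeasure

section BerezinKernel

variable (m : ℕ) (w z : ℂ)

/-- The square of the cosine of half the spherical distance between the points with affine
coordinates `w` and `z`. -/
noncomputable def cosSq : ℝ :=
  ‖1 + (starRingEnd ℂ) w * z‖ ^ 2 / ((1 + ‖w‖ ^ 2) * (1 + ‖z‖ ^ 2))

/-- The kernel `|⟨e_w, e_z⟩|² / (‖e_w‖² ‖e_z‖²)`, with `e` the coherent states of `L^{⊗m}`,
normalized to be a probability density for the normalized area measure. -/
noncomputable def berezinKernel : ℝ := ((m : ℝ) + 1) * cosSq w z ^ m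

theorem cosSq_nonneg : 0 ≤ cosSq w z := by
  rw [cosSq]
  positivity

theorem berezinKernel_nonneg : 0 ≤ berezinKernel m w z :=
  mul_nonneg (by positivity) (pow_nonneg (cosSq_nonneg w z) m)

theorem continuous_cosSq : Continuous fun p : ℂ × ℂ => cosSq p.1 p.2 := by
  have hconj : Continuous fun p : ℂ × ℂ => (starRingEnd ℂ) p.1 :=
    Complex.continuous_conj.comp continuous_fst
  exact (((continuous_const.add (hconj.mul continuous_snd)).norm).pow 2).div (by fun_prop)
    fun p => by positivity

theorem continuous_berezinKernel : Continuous fun p : ℂ × ℂ => berezinKernel m p.1 p.2 :=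
  continuous_const.mul (continuous_cosSq.pow m)

theorem cosSq_eq_one_sub : cosSq w z = 1 - ‖z - w‖ ^ 2 / ((1 + ‖w‖ ^ 2) * (1 + ‖z‖ ^ 2)) := by
  have lagrange :
      ‖1 + (starRingEnd ℂ) w * z‖ ^ 2 + ‖z - w‖ ^ 2 = (1 + ‖w‖ ^ 2) * (1 + ‖z‖ ^ 2) := by
    simp only [← Complex.normSq_eq_norm_sq, Complex.normSq_apply, Complex.add_re, Complex.add_im,
      Complex.mul_re, Complex.mul_im, Complex.conj_re, Complex.conj_im, Complex.sub_re,
      Complex.sub_im, Complex.one_re, Complex.one_im]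
    ring
  rw [cosSq, ← lagrange, eq_sub_iff_add_eq, ← add_div, lagrange, div_self (by positivity)]

theorem exists_lt_one_cosSq_le {δ : ℝ} (hδ : 0 < δ) :
    ∃ r < 1, ∀ z, δ ≤ ‖z - w‖ → cosSq w z ≤ r := by
  set K : ℝ := (1 + 2 * ‖w‖ ^ 2) / δ ^ 2 + 2
  have : 0 < K := by positivity
  refine ⟨1 - 1 / ((1 + ‖w‖ ^ 2) * K), sub_lt_self _ (by positivity), fun z hz => ?_⟩
  have norm_sq_le : ‖z‖ ^ 2 ≤ 2 * (‖w‖ ^ 2 + ‖z - w‖ ^ 2) :=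
    (pow_le_pow_left₀ (norm_nonneg z) (norm_le_norm_add_norm_sub' z w) 2).trans add_sq_le
  have const_le : 1 + 2 * ‖w‖ ^ 2 ≤ (1 + 2 * ‖w‖ ^ 2) / δ ^ 2 * ‖z - w‖ ^ 2 := by
    rw [div_mul_eq_mul_div, le_div_iff₀ (by positivity)]
    gcongr
  have one_add_norm_sq_le : 1 + ‖z‖ ^ 2 ≤ K * ‖z - w‖ ^ 2 := by
    linarith [add_mul ((1 + 2 * ‖w‖ ^ 2) / δ ^ 2) 2 (‖z - w‖ ^ 2)]
  rw [cosSq_eq_one_sub, sub_le_sub_iff_left, div_le_div_iff₀ (by positivity) (by positivity)]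
  calc 1 * ((1 + ‖w‖ ^ 2) * (1 + ‖z‖ ^ 2))
      ≤ 1 * ((1 + ‖w‖ ^ 2) * (K * ‖z - w‖ ^ 2)) := by gcongr
    _ = ‖z - w‖ ^ 2 * ((1 + ‖w‖ ^ 2) * K) := by ring

theorem tendstoUniformlyOn_berezinKernel_compl {V : Set ℂ} (hV : V ∈ 𝓝 w) :
    TendstoUniformlyOn (fun m => berezinKernel m w) 0 atTop Vᶜ := by
  obtain ⟨δ, hδ, hball⟩ := Metric.mem_nhds_iff.1 hV
  obtain ⟨r, hr_lt, hr⟩ := exists_lt_one_cosSq_le w hδ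
  have hlim : Tendsto (fun m : ℕ => ((m : ℝ) + 1) * (max r 0) ^ m) atTop (𝓝 0) := by
    have hr_lt : max r 0 < 1 := max_lt hr_lt one_pos
    simpa only [add_mul, one_mul, add_zero] using
      (tendsto_self_mul_const_pow_of_lt_one (le_max_right r 0) hr_lt).add
        (tendsto_pow_atTop_nhds_zero_of_lt_one (le_max_right r 0) hr_lt)
  rw [Metric.tendstoUniformlyOn_iff]
  intro ε hε
  filter_upwards [hlim.eventually_lt_const hε] with m hm z hz
  rw [Pi.zero_apply, dist_zero_left, Real.norm_of_nonneg (berezinKernel_nonneg m w z)]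
  have hdist : δ ≤ ‖z - w‖ := by
    rw [← dist_eq_norm]
    exact not_lt.1 fun hlt => hz (hball hlt)
  refine lt_of_le_of_lt (mul_le_mul_of_nonneg_left ?_ (by positivity)) hm
  exact pow_le_pow_left₀ (cosSq_nonneg w z) ((hr z hdist).trans (le_max_left r 0)) m

theorem integral_mul_norm_coherentState_sq (u : ℂ → ℝ) :
    ∫ z, u z * ‖(coherentState m w : L2Sections m) z‖ ^ 2 ∂sectionMeasure m =
      ‖coherentState m w‖ ^ 2 * ∫ z, berezinKernel m w z * u z ∂planeAreaMeasure := by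
  have norm_apply_sq : ∀ᵐ z ∂sectionMeasure m, ‖(coherentState m w : L2Sections m) z‖ ^ 2 =
      (((m : ℝ) + 1) / (2 * Real.pi)) ^ 2 * (‖1 + (starRingEnd ℂ) w * z‖ ^ 2) ^ m := by
    filter_upwards [ae_eq_inner_coherentState m (coherentState m w)] with z hz
    rw [hz, inner_coherentState_coherentState, norm_mul, norm_pow, Complex.norm_real,
      Real.norm_of_nonneg (by positivity), mul_pow, pow_right_comm]
  rw [integral_congr_ae (norm_apply_sq.mono fun z hz => congrArg (u z * ·) hz),
    integral_sectionMeasure_eq_planeAreaMeasure, ← integral_const_mul, ← integral_const_mul,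
    norm_coherentState_sq]
  refine integral_congr_ae (Eventually.of_forall fun z => ?_)
  simp only [berezinKernel, cosSq, div_pow, mul_pow]
  field_simp

theorem integral_berezinKernel : ∫ z, berezinKernel m w z ∂planeAreaMeasure = 1 := by
  have norm_sq_eq := integral_mul_norm_coherentState_sq m w fun _ => 1
  simp only [one_mul, mul_one] at norm_sq_eq
  rw [← norm_sq_eq_integral_sectionMeasure, Submodule.norm_coe] at norm_sq_eq
  refine mul_left_cancel₀ (a := ‖coherentState m w‖ ^ 2) ?_ (norm_sq_eq.symm.trans (mul_one _).symm)
  rw [norm_coherentState_sq]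
  positivity

theorem integrable_berezinKernel : Integrable (berezinKernel m w) planeAreaMeasure :=
  Integrable.of_integral_ne_zero (by rw [integral_berezinKernel]; exact one_ne_zero)

end BerezinKernel

section BerezinTransform

variable {u : ℂ → ℝ} {C : ℝ}

/-- The Berezin transform of `u` at level `m`: the expectation of `u` in the coherent states of
`L^{⊗m}`. -/
noncomputable def berezinTransform (m : ℕ) (u : ℂ → ℝ) (w : ℂ) : ℝ :=
  ∫ z, berezinKernel m w z * u z ∂planeAreaMeasure

theorem abs_berezinTransform_le (m : ℕ) (hC : ∀ z, |u z| ≤ C) (w : ℂ) :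
    |berezinTransform m u w| ≤ C := by
  calc |berezinTransform m u w| ≤ ∫ z, berezinKernel m w z * C ∂planeAreaMeasure := by
        refine norm_integral_le_of_norm_le (f := fun z => berezinKernel m w z * u z)
          ((integrable_berezinKernel m w).mul_const C)
          (Eventually.of_forall fun z => ?_)
        rw [norm_mul, Real.norm_of_nonneg (berezinKernel_nonneg m w z)]
        exact mul_le_mul_of_nonneg_left (hC z) (berezinKernel_nonneg m w z)
    _ = C := by rw [integral_mul_const, integral_berezinKernel, one_mul]

theorem stronglyMeasurable_berezinTransform (m : ℕ) (hu : Continuous u) :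
    StronglyMeasurable (berezinTransform m u) :=
  StronglyMeasurable.integral_prod_right (f := fun w z => berezinKernel m w z * u z)
    ((continuous_berezinKernel m).mul (hu.comp continuous_snd)).stronglyMeasurable

theorem tendsto_berezinTransform (hu : Continuous u) (hC : ∀ z, |u z| ≤ C) (w : ℂ) :
    Tendsto (fun m => berezinTransform m u w) atTop (𝓝 (u w)) := by
  have hint : Integrable u planeAreaMeasure :=
    Integrable.of_bound hu.aestronglyMeasurable C (Eventually.of_forall hC)
  refine tendsto_integral_peak_smul_of_integrable_of_tendsto MeasurableSet.univ univ_mem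
    (measure_ne_top _ _) (Eventually.of_forall fun m z => berezinKernel_nonneg m w z)
    (fun V hV hwV => tendstoUniformlyOn_berezinKernel_compl w (hV.mem_nhds hwV)) ?_
    (Eventually.of_forall fun m => (integrable_berezinKernel m w).aestronglyMeasurable)
    hint (hu.tendsto w)
  simp only [Measure.restrict_univ, integral_berezinKernel, tendsto_const_nhds]

theorem tendsto_integral_mul_berezinTransform (hu : Continuous u) (hC : ∀ z, |u z| ≤ C) :
    Tendsto (fun m => ∫ w, u w * berezinTransform m u w ∂planeAreaMeasure) atTop
      (𝓝 (∫ w, u w ^ 2 ∂planeAreaMeasure)) := by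
  refine tendsto_integral_of_dominated_convergence (fun _ => C * C)
    (fun m => hu.aestronglyMeasurable.mul
      (stronglyMeasurable_berezinTransform m hu).aestronglyMeasurable)
    (integrable_const _) (fun m => Eventually.of_forall fun w => ?_)
    (Eventually.of_forall fun w => ?_)
  · rw [norm_mul]
    exact mul_le_mul (hC w) (abs_berezinTransform_le m hC w) (norm_nonneg _)
      ((abs_nonneg _).trans (hC w))
  · simpa only [sq] using (tendsto_berezinTransform hu hC w).const_mul (u w)

end BerezinTransform

/-! ### The spectrum of Toeplitz operators -/

section TraceFormula

variable {m : ℕ} {u : ℂ → ℝ} {C : ℝ}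

theorem integral_mul_norm_coherentState_sq_planeAreaMeasure (m : ℕ) (u : ℂ → ℝ) :
    ∫ w, u w * ‖coherentState m w‖ ^ 2 ∂sectionMeasure m =
      ((m : ℝ) + 1) * ∫ w, u w ∂planeAreaMeasure := by
  simp only [norm_coherentState_sq]
  rw [integral_sectionMeasure_eq_planeAreaMeasure, ← integral_const_mul, ← integral_const_mul]
  refine integral_congr_ae (Eventually.of_forall fun w => ?_)
  field_simp

theorem integrable_mul_norm_sq (hu : Continuous u) (hC : ∀ z, |u z| ≤ C) (s : L2Sections m) :
    Integrable (fun w => u w * ‖s w‖ ^ 2) (sectionMeasure m) :=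
  ((Lp.memLp s).integrable_norm_pow two_ne_zero).bdd_mul hu.aestronglyMeasurable
    (Eventually.of_forall hC)

theorem sum_integral_mul_norm_sq (e : OrthonormalBasis (Fin (m + 1)) ℂ (holSections m))
    (hu : Continuous u) (hC : ∀ z, |u z| ≤ C) :
    ∑ k, ∫ w, u w * ‖(e k : L2Sections m) w‖ ^ 2 ∂sectionMeasure m =
      ((m : ℝ) + 1) * ∫ w, u w ∂planeAreaMeasure := by
  rw [← integral_finsetSum _ fun k _ => integrable_mul_norm_sq hu hC (e k : L2Sections m),
    ← integral_mul_norm_coherentState_sq_planeAreaMeasure]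
  refine integral_congr_ae ?_
  filter_upwards [ae_all_iff.2 fun k => ae_eq_inner_coherentState m (e k)] with w hw
  simp only [hw]
  rw [← Finset.mul_sum, e.sum_sq_norm_inner_left]

end TraceFormula

section Eigenvalues

variable {f : CP1 → ℝ} (hf : IsSmooth f) (m : ℕ)

theorem inner_toeplitz_self (s : holSections m) :
    inner ℂ s (toeplitz f hf m s) =
      ((∫ w, f (affineChart w) * ‖(s : L2Sections m) w‖ ^ 2 ∂sectionMeasure m : ℝ) : ℂ) := by
  change inner ℂ s ((holSections m).orthogonalProjectionOnto (mulOperator f hf m s)) = _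
  rw [Submodule.inner_orthogonalProjectionOnto_eq_of_mem_left, L2.inner_def,
    ← integral_complex_ofReal]
  refine integral_congr_ae ?_
  filter_upwards [(hf.memLp_mul (s : L2Sections m)).coeFn_toLp] with w hmul
  simp only [mulOperator, LinearMap.coe_mk, AddHom.coe_mk, hmul]
  rw [RCLike.inner_apply, mul_assoc, Complex.mul_conj', Complex.ofReal_mul, Complex.ofReal_pow]

/-- An orthonormal basis of eigenvectors of the Toeplitz operator `T_f^m`, in the order of the
eigenvalues `toeplitzEigenvalues f hf m`. -/
noncomputable def toeplitzEigenbasis : OrthonormalBasis (Fin (m + 1)) ℂ (holSections m) :=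
  (toeplitz_isSymmetric f hf m).eigenvectorBasis (finrank_holSections m)

theorem inner_toeplitzEigenbasis_toeplitz (k : Fin (m + 1)) (s : holSections m) :
    inner ℂ (toeplitzEigenbasis hf m k) (toeplitz f hf m s) =
      toeplitzEigenvalues f hf m k * inner ℂ (toeplitzEigenbasis hf m k) s := by
  have apply_eigenbasis : toeplitz f hf m (toeplitzEigenbasis hf m k) =
      (toeplitzEigenvalues f hf m k : ℂ) • toeplitzEigenbasis hf m k :=
    (toeplitz_isSymmetric f hf m).apply_eigenvectorBasis (finrank_holSections m) k
  rw [← toeplitz_isSymmetric f hf m, apply_eigenbasis]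
  refine (inner_smul_left (𝕜 := ℂ) (E := holSections m) _ _ _).trans ?_
  rw [Complex.conj_ofReal]

theorem sum_toeplitzEigenvalues_mul_norm_inner_sq (s : holSections m) :
    ∑ k, toeplitzEigenvalues f hf m k * ‖inner ℂ s (toeplitzEigenbasis hf m k)‖ ^ 2 =
      ∫ w, f (affineChart w) * ‖(s : L2Sections m) w‖ ^ 2 ∂sectionMeasure m := by
  refine Complex.ofReal_injective ?_
  rw [← inner_toeplitz_self hf, ← (toeplitzEigenbasis hf m).sum_inner_mul_inner,
    Complex.ofReal_sum]
  refine Finset.sum_congr rfl fun k _ => ?_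
  rw [inner_toeplitzEigenbasis_toeplitz, ← inner_conj_symm (toeplitzEigenbasis hf m k) s,
    mul_left_comm, Complex.mul_conj', Complex.ofReal_mul, Complex.ofReal_pow]

theorem toeplitzEigenvalues_eq_integral (k : Fin (m + 1)) :
    toeplitzEigenvalues f hf m k = ∫ w, f (affineChart w) *
      ‖(toeplitzEigenbasis hf m k : L2Sections m) w‖ ^ 2 ∂sectionMeasure m := by
  rw [← sum_toeplitzEigenvalues_mul_norm_inner_sq hf, Finset.sum_eq_single k]
  · rw [(toeplitzEigenbasis hf m).inner_eq_one, norm_one, one_pow, mul_one]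
  · intro j _ hjk
    rw [(toeplitzEigenbasis hf m).inner_eq_zero hjk.symm, norm_zero, zero_pow two_ne_zero, mul_zero]
  · exact fun hk => absurd (Finset.mem_univ k) hk

theorem integral_norm_toeplitzEigenbasis_sq (k : Fin (m + 1)) :
    ∫ w, ‖(toeplitzEigenbasis hf m k : L2Sections m) w‖ ^ 2 ∂sectionMeasure m = 1 := by
  rw [← norm_sq_eq_integral_sectionMeasure, Submodule.norm_coe,
    (toeplitzEigenbasis hf m).norm_eq_one, one_pow]

theorem sum_toeplitzEigenvalues :
    ∑ k, toeplitzEigenvalues f hf m k = ((m : ℝ) + 1) * ∫ p, f p ∂areaMeasure := by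
  obtain ⟨C, -, hC⟩ := hf.bounded
  rw [integral_areaMeasure hf.continuous, ← sum_integral_mul_norm_sq (toeplitzEigenbasis hf m)
    hf.1.continuous fun w => hC (affineChart w)]
  exact Finset.sum_congr rfl fun k _ => toeplitzEigenvalues_eq_integral hf m k

theorem toeplitzEigenvalues_sub_le_integral {u : ℂ → ℝ} {C t : ℝ} (hu : Continuous u)
    (hC : ∀ w, |u w| ≤ C) (hfu : ∀ w, f (affineChart w) - t ≤ u w) (k : Fin (m + 1)) :
    toeplitzEigenvalues f hf m k - t ≤
      ∫ w, u w * ‖(toeplitzEigenbasis hf m k : L2Sections m) w‖ ^ 2 ∂sectionMeasure m := by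
  obtain ⟨D, -, hD⟩ := hf.bounded
  have hint_f := integrable_mul_norm_sq hf.1.continuous (fun w => hD (affineChart w))
    (toeplitzEigenbasis hf m k : L2Sections m)
  have hint_t := integrable_mul_norm_sq (continuous_const (y := t)) (fun _ => le_rfl)
    (toeplitzEigenbasis hf m k : L2Sections m)
  calc toeplitzEigenvalues f hf m k - t
      = ∫ w, (f (affineChart w) * ‖(toeplitzEigenbasis hf m k : L2Sections m) w‖ ^ 2 -
          t * ‖(toeplitzEigenbasis hf m k : L2Sections m) w‖ ^ 2) ∂sectionMeasure m := by
        rw [integral_sub hint_f hint_t, integral_const_mul, integral_norm_toeplitzEigenbasis_sq,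
          mul_one, ← toeplitzEigenvalues_eq_integral]
    _ ≤ ∫ w, u w * ‖(toeplitzEigenbasis hf m k : L2Sections m) w‖ ^ 2 ∂sectionMeasure m := by
        refine integral_mono (hint_f.sub hint_t) (integrable_mul_norm_sq hu hC _) fun w => ?_
        simp only [← sub_mul]
        exact mul_le_mul_of_nonneg_right (hfu w) (sq_nonneg _)

/-- The Berezin–Lieb inequality for the convex functions `x ↦ (x - t)⁺`. -/
theorem sum_toeplitzEigenvalues_pos_part_le (t : ℝ) :
    ∑ k, max (toeplitzEigenvalues f hf m k - t) 0 ≤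
      ((m : ℝ) + 1) * ∫ p, max (f p - t) 0 ∂areaMeasure := by
  obtain ⟨C, hC0, hC⟩ := hf.bounded
  have hcont : Continuous fun w => max (f (affineChart w) - t) 0 :=
    (hf.1.continuous.sub continuous_const).max continuous_const
  have hbound (w : ℂ) : |max (f (affineChart w) - t) 0| ≤ C + |t| := by
    rw [abs_of_nonneg (le_max_right _ _)]
    refine max_le ?_ (by positivity)
    linarith [(abs_le.1 (hC (affineChart w))).2, neg_abs_le t]
  rw [integral_areaMeasure (u := fun p => max (f p - t) 0)
    ((hf.continuous.sub continuous_const).max continuous_const),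
    ← sum_integral_mul_norm_sq (toeplitzEigenbasis hf m) hcont hbound]
  refine Finset.sum_le_sum fun k _ => max_le ?_ ?_
  · exact toeplitzEigenvalues_sub_le_integral hf m hcont hbound (fun w => le_max_left _ _) k
  · exact integral_nonneg fun w => mul_nonneg (le_max_right _ _) (sq_nonneg _)

theorem stepMap_toeplitzEigenvalues_mem_majorized :
    stepMap m (toeplitzEigenvalues f hf m) ∈ majorized areaMeasure f := by
  have hm : (0 : ℝ) < (m : ℝ) + 1 := by positivity
  rw [mem_majorized_iff ((hf.memLp 1).integrable le_rfl)]
  constructor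
  · intro t
    rw [integral_comp_stepMap fun y => max (y - t) 0, div_le_iff₀' hm]
    exact sum_toeplitzEigenvalues_pos_part_le hf m t
  · refine (integral_comp_stepMap id _).trans ?_
    rw [div_eq_iff hm.ne', mul_comm]
    exact sum_toeplitzEigenvalues hf m

theorem sum_toeplitzEigenvalues_sq :
    ∑ k, toeplitzEigenvalues f hf m k ^ 2 = ((m : ℝ) + 1) * ∫ w, f (affineChart w) *
      berezinTransform m (f ∘ affineChart) w ∂planeAreaMeasure := by
  obtain ⟨C, -, hC⟩ := hf.bounded
  have hint (k : Fin (m + 1)) := integrable_mul_norm_sq hf.1.continuous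
    (fun w => hC (affineChart w)) (toeplitzEigenbasis hf m k : L2Sections m)
  calc ∑ k, toeplitzEigenvalues f hf m k ^ 2
      = ∫ w, ∑ k, toeplitzEigenvalues f hf m k *
          (f (affineChart w) * ‖(toeplitzEigenbasis hf m k : L2Sections m) w‖ ^ 2)
            ∂sectionMeasure m := by
        rw [integral_finsetSum _ fun k _ => (hint k).const_mul _]
        refine Finset.sum_congr rfl fun k _ => ?_
        rw [integral_const_mul, ← toeplitzEigenvalues_eq_integral, sq]
    _ = ∫ w, f (affineChart w) * berezinTransform m (f ∘ affineChart) w *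
          ‖coherentState m w‖ ^ 2 ∂sectionMeasure m := by
        refine integral_congr_ae ?_
        filter_upwards [ae_all_iff.2 fun k =>
          ae_eq_inner_coherentState m (toeplitzEigenbasis hf m k)] with w hw
        simp only [hw, mul_left_comm _ (f (affineChart w))]
        rw [← Finset.mul_sum, sum_toeplitzEigenvalues_mul_norm_inner_sq,
          integral_mul_norm_coherentState_sq, mul_right_comm, mul_assoc]
        rfl
    _ = ((m : ℝ) + 1) * ∫ w, f (affineChart w) *
          berezinTransform m (f ∘ affineChart) w ∂planeAreaMeasure :=
        integral_mul_norm_coherentState_sq_planeAreaMeasure m _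

theorem tendsto_sum_toeplitzEigenvalues_sq :
    Tendsto (fun m : ℕ => (∑ k, toeplitzEigenvalues f hf m k ^ 2) / (m + 1)) atTop
      (𝓝 (∫ p, f p ^ 2 ∂areaMeasure)) := by
  obtain ⟨C, -, hC⟩ := hf.bounded
  rw [integral_areaMeasure (u := fun p => f p ^ 2) (hf.continuous.pow 2)]
  refine (tendsto_integral_mul_berezinTransform hf.1.continuous
    fun w => hC (affineChart w)).congr fun m => ?_
  rw [sum_toeplitzEigenvalues_sq, mul_div_cancel_left₀ _ (by positivity)]
  rfl

theorem topLimsup_stepSet : topLimsup (stepSet f hf) = majorized areaMeasure f :=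
  topLimsup_image_permutohedron (hf.memLp 2)
    (fun m => (toeplitz_isSymmetric f hf m).eigenvalues_antitone (finrank_holSections m))
    (stepMap_toeplitzEigenvalues_mem_majorized hf) (tendsto_sum_toeplitzEigenvalues_sq hf)

end Eigenvalues

end ToeplitzConvexity

theorem mainTheorem1 (f : CP1 → ℝ) (hf : IsSmooth f) :
    weakClosure (topLimsup (stepSet f hf)) = majorizedSet f ∧
      closedConvexHull ℝ (smeasOrbit f hf) = weakClosure (topLimsup (stepSet f hf)) := by
  have hint : Integrable f areaMeasure := (hf.memLp 1).integrable le_rfl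
  have weakClosure_topLimsup : weakClosure (topLimsup (stepSet f hf)) = majorizedSet f := by
    rw [topLimsup_stepSet]
    exact weakClosure_eq_self (convex_majorized hint) (isClosed_majorized hint)
  refine ⟨weakClosure_topLimsup, ?_⟩
  rw [weakClosure_topLimsup]
  exact closedConvexHull_rearrangementOrbit (hf.memLp 2)
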